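/- Fix sets of participants $p,q$, labels $\ell$, payload types $b$ and type variables $X$. \emph{Session types} are generated by $$T ::= \mathsf{end} \mid p\oplus\{\ell_i(b_i).T_i\}_{i\in I} \mid p\,\&\,\{\ell_i(b_i).T_i\}_{i\in I} \mid X \mid \mu X.T,$$ where in the internal choice $\oplus$ and the external choice $\&$ the index set $I$ is finite and non-empty and the labels $\ell_i$ are pairwise distinct, and where in $\mu X.T$ (which binds $X$) every occurrence of $X$ in $T$ is inside a choice. Session types are taken up to renaming of bound variables and of indices; $T$ is \emph{over} a set $\Theta$ of variables if all its free variables lie in $\Theta$. Substitution $T[\dots]$ is capture-avoiding. The unfolding is $\mathrm{unf}(\mu X.T)=\mathrm{unf}(T)[X\mapsto\mu X.T]$, and $\mathrm{unf}(T)=T$ if $T$ is not of the form $\mu X.T'$. The relation $U\xrightarrow{p!\ell(b)}U'$ is defined inductively by the following rules. \begin{itemize} \item $p\oplus\{\ell_i(b_i).U_i\}_{i\in I}\xrightarrow{p!\ell_i(b_i)}U_i$ for $i\in I$. \item If $p\ne q$, $\emptyset\neq J\subseteq I$ and $U_i\xrightarrow{p!\ell(b)}U_i'$ for all $i\in J$,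 then $q\oplus\{\ell'_i(b'_i).U_i\}_{i\in I}\xrightarrow{p!\ell(b)}q\oplus\{\ell'_i(b'_i).U'_i\}_{i\in J}$. \item If $U_i\xrightarrow{p!\ell(b)}U_i'$ for all $i\in I$, then $q\,\&\,\{\ell'_i(b'_i).U_i\}_{i\in I}\xrightarrow{p!\ell(b)}q\,\&\,\{\ell'_i(b'_i).U'_i\}_{i\in I}$ (here $q=p$ is allowed). \item If $U[X\mapsto\mu X.U]\xrightarrow{p!\ell(b)}U'$, then $\mu X.U\xrightarrow{p!\ell(b)}U'$. \end{itemize} The predicate $\mathrm{Sends}_p$ is defined inductively: it holds of $p\oplus\{\ell_i(b_i).T_i\}_{i\in I}$; it holds of $q\oplus\{\ell_i(b_i).T_i\}_{i\in I}$ if it holds of all $T_i$; it holds of $\mu X.T$ if it holds of $T$. The relation $T\xrightarrow{p?\ell(b)}T'$ and the predicate $\mathrm{Recvs}_p$ are defined by the same rules with $\oplus$ and $\&$ exchanged. \emph{Asynchronous subtyping} $<:_\Theta$ is the largest relation between session types over $\Theta$ such that $T<:_\Theta U$ implies: \begin{enumerate} \item if $\mathrm{unf}(T)=p\oplus\{\ell_i(b_i).T_i\}_{i\in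 I}$, then for every $i\in I$ there is $U_i$ with $U\xrightarrow{p!\ell_i(b_i)}U_i$ and $T_i<:_\Theta U_i$; \item if $\mathrm{unf}(T)=p\,\&\,\{\ell_i(b_i).T_i\}_{i\in I}$, then $\mathrm{Recvs}_p(U)$; \item if $\mathrm{unf}(U)=p\oplus\{\ell_i(b_i).U_i\}_{i\in I}$, then $\mathrm{Sends}_p(T)$; \item if $\mathrm{unf}(U)=p\,\&\,\{\ell_i(b_i).U_i\}_{i\in I}$, then for every $i\in I$ there is $T_i$ with $T\xrightarrow{p?\ell_i(b_i)}T_i$ and $T_i<:_\Theta U_i$; \item for every $X\in\Theta$: $\mathrm{unf}(T)=X$ if and only if $\mathrm{unf}(U)=X$. \end{enumerate} \textbf{Lemma.} For every set $\Theta$ of type variables: \begin{itemize} \item $T<:_\Theta T$ for every session type $T$ over $\Theta$. \item If $S<:_\Theta T$ and $T<:_\Theta U$, then $S<:_\Theta U$. \item If $\emptyset\ne J\subseteq I$, all $U_i$ ($i\in I$) are session types over $\Theta$, and $T_i<:_\Theta U_i$ for all $i\in J$, then $p\oplus\{\ell_i(b_i).T_i\}_{i\in J}<:_\Theta p\oplus\{\ell_i(b_i).U_i\}_{i\in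 I}$. \item If $\emptyset\ne J\subseteq I$, all $T_i$ ($i\in I$) are session types over $\Theta$, and $T_i<:_\Theta U_i$ for all $i\in J$, then $p\,\&\,\{\ell_i(b_i).T_i\}_{i\in I}<:_\Theta p\,\&\,\{\ell_i(b_i).U_i\}_{i\in J}$. \item If $X\notin\Theta$, $T<:_{\Theta\cup\{X\}}U$, and $X$ occurs in $T$ and in $U$ only inside choices, then $\mu X.T<:_\Theta\mu X.U$. \item If $\Xi$ is a set of type variables, $T<:_{\Xi}U$, and $T_X<:_\Theta U_X$ for all $X\in\Xi$, then $T[X\mapsto T_X]_{X\in\Xi}<:_\Theta U[X\mapsto U_X]_{X\in\Xi}$ (simultaneous substitution). In particular this holds for $\Xi=\{X_1,\dots,X_n\}$. \end{itemize} -/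

import Mathlib

universe u v

/-- Raw session types over a set `Θ` of type variables, up to renaming of bound variables:
the body of a recursive type lives over `Option Θ`, where `none` is the variable being bound.
A choice carries a finite non-empty set `I` of labels, so that the labels of its branches are
distinct; the branch with label `i` has payload type `b i` and continuation `T i`. -/
inductive SType (Role Label Base : Type v) : Type u → Type (max (u + 1) v)
  | fin {Θ : Type u} : SType Role Label Base Θ
  | send {Θ : Type u} (p : Role) (I : Finset Label) (hI : I.Nonempty) (b : I → Base)
      (T : I → SType Role Label Base Θ) : SType Role Label Base Θ
  | recv {Θ : Type u} (p : Role) (I : Finset Label) (hI : I.Nonempty) (b : I → Base)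
      (T : I → SType Role Label Base Θ) : SType Role Label Base Θ
  | var {Θ : Type u} (X : Θ) : SType Role Label Base Θ
  | mu {Θ : Type u} (T : SType Role Label Base (Option Θ)) : SType Role Label Base Θ

namespace SType

variable {Role Label Base : Type v}

/-- Renaming of free variables. -/
def rename {Θ : Type u} (T : SType Role Label Base Θ) :
    {Θ' : Type u} → (Θ → Θ') → SType Role Label Base Θ' :=
  match T with
  | fin => fun _ => fin
  | send p I hI b T => fun f => send p I hI b (fun i => (T i).rename f)
  | recv p I hI b T => fun f => recv p I hI b (fun i => (T i).rename f)
  | var X => fun f => var (f X)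
  | mu T => fun f => mu (T.rename (Option.map f))

/-- A substitution, extended to leave the newly bound variable alone. -/
def lift {Θ Θ' : Type u} (σ : Θ → SType Role Label Base Θ') :
    Option Θ → SType Role Label Base (Option Θ')
  | none => var none
  | some X => (σ X).rename some

/-- Simultaneous capture-avoiding substitution. -/
def subst {Θ : Type u} (T : SType Role Label Base Θ) :
    {Θ' : Type u} → (Θ → SType Role Label Base Θ') → SType Role Label Base Θ' :=
  match T with
  | fin => fun _ => fin
  | send p I hI b T => fun σ => send p I hI b (fun i => (T i).subst σ)
  | recv p I hI b T => fun σ => recv p I hI b (fun i => (T i).subst σ)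
  | var X => fun σ => σ X
  | mu T => fun σ => mu (T.subst (lift σ))

/-- `T[X ↦ S]`, where `X` is the most recently bound variable. -/
def inst {Θ : Type u} (T : SType Role Label Base (Option Θ)) (S : SType Role Label Base Θ) :
    SType Role Label Base Θ :=
  T.subst (fun o => o.elim S var)

/-- Every free occurrence of `X` in `T` is inside an internal or external choice. -/
def GuardedIn {Θ : Type u} (T : SType Role Label Base Θ) : Θ → Prop :=
  match T with
  | fin => fun _ => True
  | send _ _ _ _ _ => fun _ => True
  | recv _ _ _ _ _ => fun _ => True
  | var Y => fun X => Y ≠ X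
  | mu T => fun X => T.GuardedIn (some X)

/-- All recursion is guarded: the raw type is a session type. -/
def WF {Θ : Type u} (T : SType Role Label Base Θ) : Prop :=
  match T with
  | fin => True
  | send _ _ _ _ T => ∀ i, (T i).WF
  | recv _ _ _ _ T => ∀ i, (T i).WF
  | var _ => True
  | mu T => T.GuardedIn none ∧ T.WF

/-- Unfolding. -/
def unfold {Θ : Type u} (T : SType Role Label Base Θ) : SType Role Label Base Θ :=
  match T with
  | fin => fin
  | send p I hI b T => send p I hI b T
  | recv p I hI b T => recv p I hI b T
  | var X => var X
  | mu T => T.unfold.inst (mu T)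

/-- `RedSend p ℓ b U U'`: an implementation of `U` may send to `p` a message with label `ℓ` and
payload type `b`, and then follow `U'`. -/
inductive RedSend (p : Role) (ℓ : Label) (b : Base) {Θ : Type u} :
    SType Role Label Base Θ → SType Role Label Base Θ → Prop
  | base (I : Finset Label) (hI : I.Nonempty) (c : I → Base)
      (U : I → SType Role Label Base Θ) (hℓ : ℓ ∈ I) (hb : c ⟨ℓ, hℓ⟩ = b) :
      RedSend p ℓ b (send p I hI c U) (U ⟨ℓ, hℓ⟩)
  | send (q : Role) (hpq : p ≠ q) (I J : Finset Label) (hI : I.Nonempty) (hJ : J.Nonempty)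
      (hJI : J ⊆ I) (c : I → Base) (U : I → SType Role Label Base Θ)
      (U' : J → SType Role Label Base Θ)
      (h : ∀ i : J, RedSend p ℓ b (U ⟨i, hJI i.2⟩) (U' i)) :
      RedSend p ℓ b (send q I hI c U) (send q J hJ (fun i => c ⟨i, hJI i.2⟩) U')
  | recv (q : Role) (I : Finset Label) (hI : I.Nonempty) (c : I → Base)
      (U U' : I → SType Role Label Base Θ) (h : ∀ i, RedSend p ℓ b (U i) (U' i)) :
      RedSend p ℓ b (recv q I hI c U) (recv q I hI c U')
  | mu (U : SType Role Label Base (Option Θ)) (U' : SType Role Label Base Θ)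
      (h : RedSend p ℓ b (U.inst (mu U)) U') : RedSend p ℓ b (mu U) U'

/-- `RedRecv p ℓ b T T'`: an implementation of `T` must accept from `p` a message with label `ℓ`
and payload type `b`, and then follow `T'`. -/
inductive RedRecv (p : Role) (ℓ : Label) (b : Base) {Θ : Type u} :
    SType Role Label Base Θ → SType Role Label Base Θ → Prop
  | base (I : Finset Label) (hI : I.Nonempty) (c : I → Base)
      (T : I → SType Role Label Base Θ) (hℓ : ℓ ∈ I) (hb : c ⟨ℓ, hℓ⟩ = b) :
      RedRecv p ℓ b (recv p I hI c T) (T ⟨ℓ, hℓ⟩)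
  | recv (q : Role) (hpq : p ≠ q) (I J : Finset Label) (hI : I.Nonempty) (hJ : J.Nonempty)
      (hJI : J ⊆ I) (c : I → Base) (T : I → SType Role Label Base Θ)
      (T' : J → SType Role Label Base Θ)
      (h : ∀ i : J, RedRecv p ℓ b (T ⟨i, hJI i.2⟩) (T' i)) :
      RedRecv p ℓ b (recv q I hI c T) (recv q J hJ (fun i => c ⟨i, hJI i.2⟩) T')
  | send (q : Role) (I : Finset Label) (hI : I.Nonempty) (c : I → Base)
      (T T' : I → SType Role Label Base Θ) (h : ∀ i, RedRecv p ℓ b (T i) (T' i)) :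
      RedRecv p ℓ b (send q I hI c T) (send q I hI c T')
  | mu (T : SType Role Label Base (Option Θ)) (T' : SType Role Label Base Θ)
      (h : RedRecv p ℓ b (T.inst (mu T)) T') : RedRecv p ℓ b (mu T) T'

/-- An implementation must send a message to `p`, without waiting for any message before. -/
inductive Sends (p : Role) : {Θ : Type u} → SType Role Label Base Θ → Prop
  | base {Θ : Type u} (I : Finset Label) (hI : I.Nonempty) (b : I → Base)
      (T : I → SType Role Label Base Θ) : Sends p (send p I hI b T)
  | send {Θ : Type u} (q : Role) (I : Finset Label) (hI : I.Nonempty) (b : I → Base)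
      (T : I → SType Role Label Base Θ) (h : ∀ i, Sends p (T i)) : Sends p (send q I hI b T)
  | mu {Θ : Type u} (T : SType Role Label Base (Option Θ)) (h : Sends p T) : Sends p (mu T)

/-- An implementation may wait for a message from `p`, without sending any message before. -/
inductive Recvs (p : Role) : {Θ : Type u} → SType Role Label Base Θ → Prop
  | base {Θ : Type u} (I : Finset Label) (hI : I.Nonempty) (b : I → Base)
      (U : I → SType Role Label Base Θ) : Recvs p (recv p I hI b U)
  | recv {Θ : Type u} (q : Role) (I : Finset Label) (hI : I.Nonempty) (b : I → Base)
      (U : I → SType Role Label Base Θ) (h : ∀ i, Recvs p (U i)) : Recvs p (recv q I hI b U)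
  | mu {Θ : Type u} (U : SType Role Label Base (Option Θ)) (h : Recvs p U) : Recvs p (mu U)

/-- The closure conditions of asynchronous subtyping, for a relation between session types
over `Θ`. -/
structure IsSimulation {Θ : Type u}
    (R : SType Role Label Base Θ → SType Role Label Base Θ → Prop) : Prop where
  wf : ∀ T U, R T U → T.WF ∧ U.WF
  left_send : ∀ T U, R T U → ∀ p I hI b T', T.unfold = send p I hI b T' →
    ∀ i : I, ∃ U', RedSend p i.1 (b i) U U' ∧ R (T' i) U'
  left_recv : ∀ T U, R T U → ∀ p I hI b T', T.unfold = recv p I hI b T' → Recvs p U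
  right_send : ∀ T U, R T U → ∀ p I hI b U', U.unfold = send p I hI b U' → Sends p T
  right_recv : ∀ T U, R T U → ∀ p I hI b U', U.unfold = recv p I hI b U' →
    ∀ i : I, ∃ T', RedRecv p i.1 (b i) T T' ∧ R T' (U' i)
  vars : ∀ T U, R T U → ∀ X : Θ, T.unfold = var X ↔ U.unfold = var X

/-- Asynchronous subtyping: the largest relation satisfying the conditions, as the union of all
of them. -/
def Sub {Θ : Type u} (T U : SType Role Label Base Θ) : Prop :=
  ∃ R : SType Role Label Base Θ → SType Role Label Base Θ → Prop, IsSimulation R ∧ R T U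

/-- The recursive type `μX.T` over a set `Θ` of named variables, for `T` over `Θ, X`. -/
noncomputable def muVar {V : Type u} {Θ : Set V} (X : V)
    (T : SType Role Label Base ↥(insert X Θ)) : SType Role Label Base ↥Θ :=
  open Classical in
  mu (T.rename fun Y => if h : Y.1 = X then none else some ⟨Y.1, Y.2.resolve_left h⟩)

end SType

namespace SType

variable {Role Label Base : Type v} {Θ Θ₁ Θ₂ : Type u}

/-! ### Renaming and substitution -/

/-! The conditions are symmetric: exchanging the two kinds of choice while reversing the relation
maps them to themselves. So choices and reductions carry a Boolean polarity, and a simulation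
(`IsSim`, `SubP`) is carried together with its converse, which halves the cases. Everything is
phrased through `out`, the head of the unfolding. Recursion then disappears from the reduction
rules, and `SubP` makes sense for raw types; guardedness is needed for the recursion rule and for
the comparison with the given definitions.

Transitivity is shown by composing relations, which requires that subtyping transports reductions
(`SubP.red`) and the unavoidability of a choice (`SubP.seq`) from the middle type to the outer one.
Both use a nested induction: the outer one on the height of the datum to be transported, the inner
one on the number of choices the target makes before it reaches the partner at the head of the
source. Three facts carry it: reductions of opposite polarity commute without gaining height
(`RedN.commute`); reductions of equal polarity with distinct partners can be exchanged for a whole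
family of labels at once (`Red.exchange`); and for a type that is a choice it suffices to match its
branches, all conditions from the other side being consequences (`SubP.of_matched`). The last fact
also gives the two choice rules.

Substitution and recursion share one relation, `SubstRel`: instances of related types whose head is
not a variable. Such an instance shows at least one layer of the original types, so the substituted
types may be related by `SubstRel` itself; for recursion they are the recursive types in question.

In the translation back to the inductive definitions the delicate point is that `Sends` and `Recvs`
inspect the body of a recursion with its variable free, whereas `Seq` follows unfoldings;
`SeqN.seqOf_or` bridges this. -/

theorem rename_rename (T : SType Role Label Base Θ) :
    ∀ {Θ₁ Θ₂ : Type u} (f : Θ → Θ₁) (g : Θ₁ → Θ₂),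
      (T.rename f).rename g = T.rename (g ∘ f) := by
  induction T with
  | fin => intros; rfl
  | send p I hI b T ih => intros; simp only [rename, ih]
  | recv p I hI b T ih => intros; simp only [rename, ih]
  | var X => intros; rfl
  | mu T ih => intros; simp only [rename, ih, Option.map_comp_map]

theorem lift_comp_map (f : Θ → Θ₁) (σ : Θ₁ → SType Role Label Base Θ₂) :
    lift σ ∘ Option.map f = lift (σ ∘ f) := by
  funext o; cases o <;> rfl

theorem subst_rename (T : SType Role Label Base Θ) :
    ∀ {Θ₁ Θ₂ : Type u} (f : Θ → Θ₁) (σ : Θ₁ → SType Role Label Base Θ₂),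
      (T.rename f).subst σ = T.subst (σ ∘ f) := by
  induction T with
  | fin => intros; rfl
  | send p I hI b T ih => intros; simp only [rename, subst, ih]
  | recv p I hI b T ih => intros; simp only [rename, subst, ih]
  | var X => intros; rfl
  | mu T ih => intros; simp only [rename, subst, ih, lift_comp_map]

theorem rename_lift (σ : Θ → SType Role Label Base Θ₁) (f : Θ₁ → Θ₂) :
    (fun o => (lift σ o).rename (Option.map f)) = lift (fun X => (σ X).rename f) := by
  funext o
  cases o with
  | none => rfl
  | some X => simp only [lift, rename_rename]; rfl

theorem rename_subst (T : SType Role Label Base Θ) :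
    ∀ {Θ₁ Θ₂ : Type u} (σ : Θ → SType Role Label Base Θ₁) (f : Θ₁ → Θ₂),
      (T.subst σ).rename f = T.subst (fun X => (σ X).rename f) := by
  induction T with
  | fin => intros; rfl
  | send p I hI b T ih => intros; simp only [rename, subst, ih]
  | recv p I hI b T ih => intros; simp only [rename, subst, ih]
  | var X => intros; rfl
  | mu T ih => intros; simp only [rename, subst, ih, rename_lift]

theorem subst_lift (σ : Θ → SType Role Label Base Θ₁) (τ : Θ₁ → SType Role Label Base Θ₂) :
    (fun o => (lift σ o).subst (lift τ)) = lift (fun X => (σ X).subst τ) := by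
  funext o
  cases o with
  | none => rfl
  | some X => simp only [lift, subst_rename, rename_subst]; rfl

theorem subst_subst (T : SType Role Label Base Θ) :
    ∀ {Θ₁ Θ₂ : Type u} (σ : Θ → SType Role Label Base Θ₁) (τ : Θ₁ → SType Role Label Base Θ₂),
      (T.subst σ).subst τ = T.subst (fun X => (σ X).subst τ) := by
  induction T with
  | fin => intros; rfl
  | send p I hI b T ih => intros; simp only [subst, ih]
  | recv p I hI b T ih => intros; simp only [subst, ih]
  | var X => intros; rfl
  | mu T ih => intros; simp only [subst, ih, subst_lift]

theorem lift_var : lift (var : Θ → SType Role Label Base Θ) = var := by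
  funext o; cases o <;> rfl

theorem subst_var (T : SType Role Label Base Θ) : T.subst var = T := by
  induction T with
  | fin => rfl
  | send p I hI b T ih => simp only [subst, ih]
  | recv p I hI b T ih => simp only [subst, ih]
  | var X => rfl
  | mu T ih => simp only [subst, lift_var, ih]

theorem rename_eq_subst (T : SType Role Label Base Θ) (f : Θ → Θ₁) :
    T.rename f = T.subst (fun X => var (f X)) := by
  conv_lhs => rw [← subst_var T, rename_subst]
  rfl

theorem inst_rename_some (T S : SType Role Label Base Θ) : (T.rename some).inst S = T := by
  rw [inst, subst_rename]
  exact subst_var T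

theorem inst_subst_lift (T : SType Role Label Base (Option Θ)) (σ : Θ → SType Role Label Base Θ₁)
    (S : SType Role Label Base Θ₁) :
    (T.subst (lift σ)).inst S = T.subst (fun o => o.elim S σ) := by
  rw [inst, subst_subst]
  congr 1
  funext o
  cases o with
  | none => rfl
  | some X => exact inst_rename_some _ _

theorem subst_inst (T : SType Role Label Base (Option Θ)) (S : SType Role Label Base Θ)
    (σ : Θ → SType Role Label Base Θ₁) :
    (T.inst S).subst σ = T.subst (fun o => o.elim (S.subst σ) σ) := by
  rw [inst, subst_subst]
  congr 1
  funext o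
  cases o <;> rfl

/-! ### Guardedness and well-formedness -/

theorem GuardedIn.rename {T : SType Role Label Base Θ} :
    ∀ {Θ₁ : Type u} {f : Θ → Θ₁} {Y : Θ₁}, (∀ X, f X = Y → T.GuardedIn X) →
      (T.rename f).GuardedIn Y := by
  induction T with
  | fin => intros; trivial
  | send p I hI b T ih => intros; trivial
  | recv p I hI b T ih => intros; trivial
  | var X => intro _ f Y h hXY; exact h X hXY rfl
  | mu T ih =>
    intro _ f Y h
    refine ih fun o ho => ?_
    cases o with
    | none => cases ho
    | some X => exact h X (Option.some.inj ho)

theorem GuardedIn.subst {T : SType Role Label Base Θ} :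
    ∀ {Θ₁ : Type u} {σ : Θ → SType Role Label Base Θ₁} {Y : Θ₁},
      (∀ X, T.GuardedIn X ∨ (σ X).GuardedIn Y) → (T.subst σ).GuardedIn Y := by
  induction T with
  | fin => intros; trivial
  | send p I hI b T ih => intros; trivial
  | recv p I hI b T ih => intros; trivial
  | var X => intro _ σ Y h; exact (h X).resolve_left fun h => h rfl
  | mu T ih =>
    intro _ σ Y h
    refine ih fun o => ?_
    cases o with
    | none => exact Or.inr (Option.some_ne_none Y).symm
    | some X =>
      refine (h X).imp id fun hX => GuardedIn.rename fun Z hZ => ?_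
      cases hZ; exact hX

theorem WF.rename {T : SType Role Label Base Θ} (hT : T.WF) :
    ∀ {Θ₁ : Type u} (f : Θ → Θ₁), (T.rename f).WF := by
  induction T with
  | fin => intros; trivial
  | send p I hI b T ih => intro _ f i; exact ih i (hT i) f
  | recv p I hI b T ih => intro _ f i; exact ih i (hT i) f
  | var X => intros; trivial
  | mu T ih =>
    intro _ f
    refine ⟨GuardedIn.rename fun o ho => ?_, ih hT.2 _⟩
    cases o with
    | none => exact hT.1
    | some X => cases ho

theorem WF.subst {T : SType Role Label Base Θ} (hT : T.WF) :
    ∀ {Θ₁ : Type u} {σ : Θ → SType Role Label Base Θ₁}, (∀ X, (σ X).WF) → (T.subst σ).WF := by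
  induction T with
  | fin => intros; trivial
  | send p I hI b T ih => intro _ σ h i; exact ih i (hT i) h
  | recv p I hI b T ih => intro _ σ h i; exact ih i (hT i) h
  | var X => intro _ σ h; exact h X
  | mu T ih =>
    intro _ σ h
    refine ⟨GuardedIn.subst fun o => ?_, ih hT.2 fun o => ?_⟩
    · cases o with
      | none => exact Or.inl hT.1
      | some X => exact Or.inr (GuardedIn.rename fun Z hZ => by cases hZ)
    · cases o with
      | none => trivial
      | some X => exact (h X).rename some

theorem WF.inst {T : SType Role Label Base (Option Θ)} {S : SType Role Label Base Θ}
    (hT : T.WF) (hS : S.WF) : (T.inst S).WF :=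
  hT.subst fun o => by cases o; exacts [hS, trivial]

/-! ### Unfolding -/

theorem unfold_rename (T : SType Role Label Base Θ) :
    ∀ {Θ₁ : Type u} (f : Θ → Θ₁), (T.rename f).unfold = T.unfold.rename f := by
  induction T with
  | fin => intros; rfl
  | send p I hI b T ih => intros; rfl
  | recv p I hI b T ih => intros; rfl
  | var X => intros; rfl
  | mu T ih =>
    intro _ f
    simp only [rename, unfold, ih, inst, subst_rename, rename_subst]
    congr 1
    funext o
    cases o <;> rfl

/-- The two cases are separate because a type that unfolds to a variable goes on unfolding inside
whatever replaces that variable. No guardedness is needed. -/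
theorem unfold_subst (T : SType Role Label Base Θ) :
    ∀ {Θ₁ : Type u} (σ : Θ → SType Role Label Base Θ₁),
      (∀ X, T.unfold = var X → (T.subst σ).unfold = (σ X).unfold) ∧
      ((∀ X, T.unfold ≠ var X) → (T.subst σ).unfold = T.unfold.subst σ) := by
  induction T with
  | fin => intro _ σ; exact ⟨fun X h => (by cases h), fun _ => rfl⟩
  | send p I hI b T ih => intro _ σ; exact ⟨fun X h => (by cases h), fun _ => rfl⟩
  | recv p I hI b T ih => intro _ σ; exact ⟨fun X h => (by cases h), fun _ => rfl⟩
  | var X => intro _ σ; exact ⟨fun Y h => (by cases h; rfl), fun h => absurd rfl (h X)⟩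
  | mu T ih =>
    intro _ σ
    obtain ⟨ih₁, ih₂⟩ := ih (lift σ)
    by_cases hv : ∃ o, T.unfold = var o
    · obtain ⟨o, ho⟩ := hv
      have h₁ := ih₁ o ho
      cases o with
      -- Here the recursion is unguarded, and it unfolds to itself both before and after the
      -- substitution.
      | none =>
        simp only [subst, unfold, h₁, ho]
        exact ⟨fun X h => (by cases h), fun _ => rfl⟩
      | some Y =>
        simp only [subst, unfold, h₁, ho, lift, unfold_rename, inst_rename_some]
        exact ⟨fun X h => (by cases h; rfl), fun h => absurd rfl (h Y)⟩
    · push Not at hv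
      have h₂ := ih₂ hv
      simp only [subst, unfold, h₂, inst_subst_lift, subst_inst]
      refine ⟨fun X h => ?_, fun _ => trivial⟩
      generalize hT : T.unfold = T' at h hv
      cases T' with
      | var o => exact absurd rfl (hv o)
      | _ => cases h

theorem GuardedIn.unfold_ne {T : SType Role Label Base Θ} :
    ∀ {X : Θ}, T.GuardedIn X → T.unfold ≠ var X := by
  induction T with
  | fin => intro X _ h; cases h
  | send p I hI b T ih => intro X _ h; cases h
  | recv p I hI b T ih => intro X _ h; cases h
  | var Y => intro X h h'; cases h'; exact h rfl
  | mu T ih =>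
    intro X hX h
    have hT := ih hX
    simp only [unfold] at h
    generalize T.unfold = T' at h hT
    cases T' with
    | var o =>
      cases o with
      | none => cases h
      | some Y => cases h; exact hT rfl
    | _ => cases h

theorem unfold_inst_mu {T : SType Role Label Base (Option Θ)} (hT : T.GuardedIn none) :
    (T.inst (mu T)).unfold = (mu T).unfold := by
  obtain ⟨h₁, h₂⟩ := unfold_subst T (fun o => o.elim (mu T) var)
  by_cases hv : ∃ o, T.unfold = var o
  · obtain ⟨o, ho⟩ := hv
    cases o with
    | none => exact absurd ho hT.unfold_ne
    | some Y =>
      rw [inst, h₁ _ ho]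
      simp only [unfold, ho]
      rfl
  · push Not at hv
    exact h₂ hv

theorem WF.unfold {T : SType Role Label Base Θ} (hT : T.WF) : T.unfold.WF := by
  induction T with
  | mu T ih => exact (ih hT.2).inst hT
  | _ => exact hT

/-- The number of recursion binders in front of a type. -/
def muDepth {Θ : Type u} (T : SType Role Label Base Θ) : ℕ :=
  match T with
  | mu T => T.muDepth + 1
  | _ => 0

theorem muDepth_rename (T : SType Role Label Base Θ) :
    ∀ {Θ₁ : Type u} (f : Θ → Θ₁), (T.rename f).muDepth = T.muDepth := by
  induction T with
  | mu T ih => intro _ f; simp only [rename, muDepth, ih]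
  | _ => intros; rfl

/-- Only a variable standing directly below the leading binders could contribute new ones. This
makes `muDepth` drop by one when a guarded recursion is unfolded once. -/
theorem muDepth_subst (T : SType Role Label Base Θ) :
    ∀ {Θ₁ : Type u} (σ : Θ → SType Role Label Base Θ₁),
      (∀ X, T.GuardedIn X ∨ (σ X).muDepth = 0) → (T.subst σ).muDepth = T.muDepth := by
  induction T with
  | fin => intros; rfl
  | send p I hI b T ih => intros; rfl
  | recv p I hI b T ih => intros; rfl
  | var X => intro _ σ h; exact (h X).resolve_left fun h => h rfl
  | mu T ih =>
    intro _ σ h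
    simp only [subst, muDepth]
    rw [ih]
    intro o
    cases o with
    | none => exact Or.inr rfl
    | some X => exact (h X).imp id fun h => (muDepth_rename _ _).trans h

/-- A property that a recursive type inherits from its one-step unfolding is inherited from the
full unfolding. -/
theorem of_unfold {P : SType Role Label Base Θ → Prop} (hP : ∀ T, P (T.inst (mu T)) → P (mu T))
    {T : SType Role Label Base Θ} (hT : T.WF) (h : P T.unfold) : P T := by
  generalize hn : T.muDepth = n
  induction n generalizing T with
  | zero => cases T with
    | mu T => cases hn
    | _ => exact h
  | succ n ih =>
    cases T with
    | mu T =>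
      refine hP T (ih (hT.2.inst hT) ?_ ?_)
      · rwa [unfold_inst_mu hT.1]
      · rw [inst, muDepth_subst]
        · exact Nat.succ.inj hn
        · intro o
          cases o
          exacts [Or.inl hT.1, Or.inr rfl]
    | _ => exact h

/-! ### Heads -/

/-- A choice of the given polarity: internal for `true`, external for `false`. -/
def choice (s : Bool) (p : Role) (I : Finset Label) (hI : I.Nonempty) (b : I → Base)
    (T : I → SType Role Label Base Θ) : SType Role Label Base Θ :=
  match s with
  | true => send p I hI b T
  | false => recv p I hI b T

/-- The top of the unfolding of a type. -/
inductive Head (Role Label Base : Type v) (Θ : Type u) : Type (max (u + 1) v)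
  | fin
  | var (X : Θ)
  | choice (s : Bool) (p : Role) (I : Finset Label) (hI : I.Nonempty) (b : I → Base)
      (T : I → SType Role Label Base Θ)

/-- The top of a type that is not recursive. -/
def head (T : SType Role Label Base Θ) : Head Role Label Base Θ :=
  match T with
  | fin => .fin
  | send p I hI b T => .choice true p I hI b T
  | recv p I hI b T => .choice false p I hI b T
  | var X => .var X
  -- A default value: a binder survives unfolding only if the recursion is unguarded.
  | mu _ => .fin

/-- The top of the unfolding of a type. -/
def out (T : SType Role Label Base Θ) : Head Role Label Base Θ := T.unfold.head

@[simp] theorem out_choice (s : Bool) (p : Role) (I : Finset Label) (hI : I.Nonempty)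
    (b : I → Base) (T : I → SType Role Label Base Θ) :
    (choice s p I hI b T).out = .choice s p I hI b T := by
  cases s <;> rfl

theorem out_eq_choice {T : SType Role Label Base Θ} {s : Bool} {p : Role} {I : Finset Label}
    {hI : I.Nonempty} {b : I → Base} {T' : I → SType Role Label Base Θ} :
    T.out = .choice s p I hI b T' ↔ T.unfold = choice s p I hI b T' := by
  rw [out]
  generalize T.unfold = S
  constructor
  · intro h
    cases S <;> cases h <;> rfl
  · rintro rfl
    cases s <;> rfl

theorem out_eq_var {T : SType Role Label Base Θ} {X : Θ} :
    T.out = .var X ↔ T.unfold = var X := by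
  rw [out]
  generalize T.unfold = S
  constructor
  · intro h
    cases S <;> cases h
    rfl
  · rintro rfl
    rfl

theorem choice_subst (s : Bool) (p : Role) (I : Finset Label) (hI : I.Nonempty)
    (b : I → Base) (T : I → SType Role Label Base Θ) (σ : Θ → SType Role Label Base Θ₁) :
    (choice s p I hI b T).subst σ = choice s p I hI b (fun i => (T i).subst σ) := by
  cases s <;> rfl

theorem wf_choice {s : Bool} {p : Role} {I : Finset Label} {hI : I.Nonempty}
    {b : I → Base} {T : I → SType Role Label Base Θ} :
    (choice s p I hI b T).WF ↔ ∀ i, (T i).WF := by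
  cases s <;> rfl

theorem out_subst_of_choice {T : SType Role Label Base Θ} {s : Bool} {p : Role}
    {I : Finset Label} {hI : I.Nonempty} {b : I → Base} {T' : I → SType Role Label Base Θ}
    (h : T.out = .choice s p I hI b T') (σ : Θ → SType Role Label Base Θ₁) :
    (T.subst σ).out = .choice s p I hI b (fun i => (T' i).subst σ) := by
  rw [out_eq_choice] at h ⊢
  rw [(unfold_subst T σ).2, h, choice_subst]
  intro X hX
  rw [h] at hX
  cases s <;> cases hX

theorem out_subst_of_var {T : SType Role Label Base Θ} {X : Θ} (h : T.out = .var X)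
    (σ : Θ → SType Role Label Base Θ₁) : (T.subst σ).out = (σ X).out := by
  rw [out, (unfold_subst T σ).1 X (out_eq_var.1 h), out]

theorem out_subst_of_fin {T : SType Role Label Base Θ} (h : T.out = .fin)
    (σ : Θ → SType Role Label Base Θ₁) : (T.subst σ).out = .fin := by
  have hv : ∀ X, T.unfold ≠ var X := fun X hX => by
    rw [← out_eq_var, h] at hX
    cases hX
  rw [out, (unfold_subst T σ).2 hv]
  rw [out] at h
  generalize T.unfold = S at h hv
  cases S with
  | var X => exact absurd rfl (hv X)
  | send => cases h
  | recv => cases h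
  | _ => rfl

theorem out_inst_mu {T : SType Role Label Base (Option Θ)} (hT : T.GuardedIn none) :
    (T.inst (mu T)).out = (mu T).out := by
  rw [out, unfold_inst_mu hT, out]

theorem WF.of_out {T : SType Role Label Base Θ} (hT : T.WF) {s : Bool} {p : Role}
    {I : Finset Label} {hI : I.Nonempty} {b : I → Base} {T' : I → SType Role Label Base Θ}
    (h : T.out = .choice s p I hI b T') (i : I) : (T' i).WF := by
  have := hT.unfold
  rw [out_eq_choice.1 h, wf_choice] at this
  exact this i

/-! ### Reductions through heads -/

/-- Reduction of height at most `n`, by sending for `s = true` and by receiving for `s = false`. -/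
inductive RedN (s : Bool) (p : Role) (ℓ : Label) (b : Base) {Θ : Type u} :
    ℕ → SType Role Label Base Θ → SType Role Label Base Θ → Prop
  | base {n : ℕ} {U : SType Role Label Base Θ} {I : Finset Label} {hI : I.Nonempty}
      {c : I → Base} {V : I → SType Role Label Base Θ} (hU : U.out = .choice s p I hI c V)
      (hℓ : ℓ ∈ I) (hb : c ⟨ℓ, hℓ⟩ = b) : RedN s p ℓ b (n + 1) U (V ⟨ℓ, hℓ⟩)
  | same {n : ℕ} {U : SType Role Label Base Θ} {q : Role} {I : Finset Label} {hI : I.Nonempty}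
      {c : I → Base} {V : I → SType Role Label Base Θ} (hU : U.out = .choice s q I hI c V)
      (hpq : p ≠ q) (J : Finset Label) (hJ : J.Nonempty) (hJI : J ⊆ I)
      (V' : J → SType Role Label Base Θ)
      (h : ∀ i : J, RedN s p ℓ b n (V ⟨i, hJI i.2⟩) (V' i)) :
      RedN s p ℓ b (n + 1) U (choice s q J hJ (fun i => c ⟨i, hJI i.2⟩) V')
  | opp {n : ℕ} {U : SType Role Label Base Θ} {s' : Bool} {q : Role} {I : Finset Label}
      {hI : I.Nonempty} {c : I → Base} {V : I → SType Role Label Base Θ}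
      (hU : U.out = .choice s' q I hI c V) (hs : s' ≠ s) (V' : I → SType Role Label Base Θ)
      (h : ∀ i, RedN s p ℓ b n (V i) (V' i)) :
      RedN s p ℓ b (n + 1) U (choice s' q I hI c V')

/-- Every path meets a choice of polarity `s` with `p` after at most `n` choices of
polarity `s`. -/
inductive SeqN (s : Bool) (p : Role) {Θ : Type u} : ℕ → SType Role Label Base Θ → Prop
  | base {n : ℕ} {T : SType Role Label Base Θ} {I : Finset Label} {hI : I.Nonempty}
      {b : I → Base} {V : I → SType Role Label Base Θ} (hT : T.out = .choice s p I hI b V) :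
      SeqN s p (n + 1) T
  | step {n : ℕ} {T : SType Role Label Base Θ} {q : Role} {I : Finset Label} {hI : I.Nonempty}
      {b : I → Base} {V : I → SType Role Label Base Θ} (hT : T.out = .choice s q I hI b V)
      (h : ∀ i, SeqN s p n (V i)) : SeqN s p (n + 1) T

variable {s s' : Bool} {p q : Role} {ℓ ℓ' : Label} {b b' : Base} {n : ℕ}

theorem RedN.mono {U U' : SType Role Label Base Θ} (h : RedN s p ℓ b n U U') :
    ∀ {m : ℕ}, n ≤ m → RedN s p ℓ b m U U' := by
  induction h with
  | base hU hℓ hb =>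
    intro m hm
    obtain ⟨m, rfl⟩ := Nat.exists_eq_add_of_le' (Nat.le_of_add_left_le hm)
    exact .base hU hℓ hb
  | same hU hpq J hJ hJI V' h ih =>
    intro m hm
    obtain ⟨m, rfl⟩ := Nat.exists_eq_add_of_le' (Nat.le_of_add_left_le hm)
    exact .same hU hpq J hJ hJI V' fun i => ih i (Nat.le_of_succ_le_succ hm)
  | opp hU hs V' h ih =>
    intro m hm
    obtain ⟨m, rfl⟩ := Nat.exists_eq_add_of_le' (Nat.le_of_add_left_le hm)
    exact .opp hU hs V' fun i => ih i (Nat.le_of_succ_le_succ hm)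

theorem SeqN.mono {T : SType Role Label Base Θ} (h : SeqN s p n T) :
    ∀ {m : ℕ}, n ≤ m → SeqN s p m T := by
  induction h with
  | base hT =>
    intro m hm
    obtain ⟨m, rfl⟩ := Nat.exists_eq_add_of_le' (Nat.le_of_add_left_le hm)
    exact .base hT
  | step hT h ih =>
    intro m hm
    obtain ⟨m, rfl⟩ := Nat.exists_eq_add_of_le' (Nat.le_of_add_left_le hm)
    exact .step hT fun i => ih i (Nat.le_of_succ_le_succ hm)

/-- Choices branch finitely, so the heights found in the branches have a common bound; this lets
`Red` and `Seq` obey the rules of `RedN` and `SeqN`. -/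
theorem exists_uniform_height {ι : Type*} [Finite ι] {P : ι → ℕ → Prop}
    (mono : ∀ i m n, m ≤ n → P i m → P i n) (h : ∀ i, ∃ n, P i n) : ∃ n, ∀ i, P i n := by
  choose f hf using h
  obtain ⟨n, hn⟩ := (Set.finite_range f).bddAbove
  exact ⟨n, fun i => mono i _ _ (hn ⟨i, rfl⟩) (hf i)⟩

/-- Reduction of arbitrary height. -/
def Red (s : Bool) (p : Role) (ℓ : Label) (b : Base) (U U' : SType Role Label Base Θ) : Prop :=
  ∃ n, RedN s p ℓ b n U U'

/-- Every path meets a choice of polarity `s` with `p` after finitely many choices of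
polarity `s`. -/
def Seq (s : Bool) (p : Role) (T : SType Role Label Base Θ) : Prop :=
  ∃ n, SeqN s p n T

theorem RedN.congr {U U₁ U' : SType Role Label Base Θ} (h : RedN s p ℓ b n U U')
    (e : U.out = U₁.out) : RedN s p ℓ b n U₁ U' := by
  cases h with
  | base hU hℓ hb => exact .base (e ▸ hU) hℓ hb
  | same hU hpq J hJ hJI V' h => exact .same (e ▸ hU) hpq J hJ hJI V' h
  | opp hU hs V' h => exact .opp (e ▸ hU) hs V' h

theorem Red.congr {U U₁ U' : SType Role Label Base Θ} (h : Red s p ℓ b U U')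
    (e : U.out = U₁.out) : Red s p ℓ b U₁ U' :=
  h.imp fun _ h => h.congr e

theorem SeqN.congr {T T₁ : SType Role Label Base Θ} (h : SeqN s p n T)
    (e : T.out = T₁.out) : SeqN s p n T₁ := by
  cases h with
  | base hT => exact .base (e ▸ hT)
  | step hT h => exact .step (e ▸ hT) h

theorem Seq.congr {T T₁ : SType Role Label Base Θ} (h : Seq s p T)
    (e : T.out = T₁.out) : Seq s p T₁ :=
  h.imp fun _ h => h.congr e

section

variable {U : SType Role Label Base Θ} {I : Finset Label} {hI : I.Nonempty} {c : I → Base}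
  {V : I → SType Role Label Base Θ}

theorem Red.base (hU : U.out = .choice s p I hI c V) (i : I) : Red s p i.1 (c i) U (V i) :=
  ⟨1, .base hU i.2 rfl⟩

theorem Red.same (hU : U.out = .choice s q I hI c V) (hpq : p ≠ q) (J : Finset Label)
    (hJ : J.Nonempty) (hJI : J ⊆ I) (V' : J → SType Role Label Base Θ)
    (h : ∀ i : J, Red s p ℓ b (V ⟨i, hJI i.2⟩) (V' i)) :
    Red s p ℓ b U (choice s q J hJ (fun i => c ⟨i, hJI i.2⟩) V') := by
  obtain ⟨n, hn⟩ :=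
    exists_uniform_height (ι := J) (P := fun i n => RedN s p ℓ b n (V ⟨i, hJI i.2⟩) (V' i))
      (fun _ _ _ hmn h => h.mono hmn) h
  exact ⟨n + 1, .same hU hpq J hJ hJI V' hn⟩

theorem Red.opp (hU : U.out = .choice s' q I hI c V) (hs : s' ≠ s)
    (V' : I → SType Role Label Base Θ) (h : ∀ i, Red s p ℓ b (V i) (V' i)) :
    Red s p ℓ b U (choice s' q I hI c V') := by
  obtain ⟨n, hn⟩ :=
    exists_uniform_height (P := fun i n => RedN s p ℓ b n (V i) (V' i))
      (fun _ _ _ hmn h => h.mono hmn) h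
  exact ⟨n + 1, .opp hU hs V' hn⟩

theorem Seq.base (hU : U.out = .choice s p I hI c V) : Seq s p U := ⟨1, .base hU⟩

theorem Seq.step (hU : U.out = .choice s q I hI c V) (h : ∀ i, Seq s p (V i)) : Seq s p U := by
  obtain ⟨n, hn⟩ :=
    exists_uniform_height (P := fun i n => SeqN s p n (V i))
      (fun _ _ _ hmn h => h.mono hmn) h
  exact ⟨n + 1, .step hU hn⟩

/-! Inversion of reductions, by the head of the source. -/

theorem RedN.inv_base {U' : SType Role Label Base Θ} (h : RedN s p ℓ b (n + 1) U U')
    (hU : U.out = .choice s p I hI c V) :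
    ∃ hℓ : ℓ ∈ I, c ⟨ℓ, hℓ⟩ = b ∧ U' = V ⟨ℓ, hℓ⟩ := by
  cases h with
  | base hU' hℓ hb => rw [hU] at hU'; cases hU'; exact ⟨hℓ, hb, rfl⟩
  | same hU' hpq => rw [hU] at hU'; cases hU'; exact absurd rfl hpq
  | opp hU' hs => rw [hU] at hU'; cases hU'; exact absurd rfl hs

theorem RedN.inv_same {U' : SType Role Label Base Θ} (h : RedN s p ℓ b (n + 1) U U')
    (hU : U.out = .choice s q I hI c V) (hpq : p ≠ q) :
    ∃ (J : Finset Label) (hJ : J.Nonempty) (hJI : J ⊆ I) (V' : J → SType Role Label Base Θ),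
      U' = choice s q J hJ (fun i => c ⟨i, hJI i.2⟩) V' ∧
      ∀ i : J, RedN s p ℓ b n (V ⟨i, hJI i.2⟩) (V' i) := by
  cases h with
  | base hU' hℓ hb => rw [hU] at hU'; cases hU'; exact absurd rfl hpq
  | same hU' hpq J hJ hJI V' h =>
    rw [hU] at hU'; cases hU'; exact ⟨J, hJ, hJI, V', rfl, h⟩
  | opp hU' hs => rw [hU] at hU'; cases hU'; exact absurd rfl hs

theorem RedN.inv_opp {U' : SType Role Label Base Θ} (h : RedN s p ℓ b (n + 1) U U')
    (hU : U.out = .choice s' q I hI c V) (hs : s' ≠ s) :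
    ∃ V' : I → SType Role Label Base Θ,
      U' = choice s' q I hI c V' ∧ ∀ i, RedN s p ℓ b n (V i) (V' i) := by
  cases h with
  | base hU' hℓ hb => rw [hU] at hU'; cases hU'; exact absurd rfl hs
  | same hU' hpq J hJ hJI V' h => rw [hU] at hU'; cases hU'; exact absurd rfl hs
  | opp hU' hs V' h => rw [hU] at hU'; cases hU'; exact ⟨V', rfl, h⟩

theorem RedN.exists_succ {U U' : SType Role Label Base Θ} (h : RedN s p ℓ b n U U') :
    ∃ m, n = m + 1 := by
  cases h <;> exact ⟨_, rfl⟩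

theorem Red.exists_succ {U U' : SType Role Label Base Θ} (h : Red s p ℓ b U U') :
    ∃ n, RedN s p ℓ b (n + 1) U U' := by
  obtain ⟨n, h⟩ := h
  obtain ⟨m, rfl⟩ := h.exists_succ
  exact ⟨m, h⟩

theorem Red.inv_base {U' : SType Role Label Base Θ} (h : Red s p ℓ b U U')
    (hU : U.out = .choice s p I hI c V) :
    ∃ hℓ : ℓ ∈ I, c ⟨ℓ, hℓ⟩ = b ∧ U' = V ⟨ℓ, hℓ⟩ :=
  let ⟨_, h⟩ := h.exists_succ
  h.inv_base hU

theorem Red.inv_same {U' : SType Role Label Base Θ} (h : Red s p ℓ b U U')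
    (hU : U.out = .choice s q I hI c V) (hpq : p ≠ q) :
    ∃ (J : Finset Label) (hJ : J.Nonempty) (hJI : J ⊆ I) (V' : J → SType Role Label Base Θ),
      U' = choice s q J hJ (fun i => c ⟨i, hJI i.2⟩) V' ∧
      ∀ i : J, Red s p ℓ b (V ⟨i, hJI i.2⟩) (V' i) :=
  let ⟨n, h⟩ := h.exists_succ
  let ⟨J, hJ, hJI, V', e, h⟩ := h.inv_same hU hpq
  ⟨J, hJ, hJI, V', e, fun i => ⟨n, h i⟩⟩

theorem Red.inv_opp {U' : SType Role Label Base Θ} (h : Red s p ℓ b U U')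
    (hU : U.out = .choice s' q I hI c V) (hs : s' ≠ s) :
    ∃ V' : I → SType Role Label Base Θ,
      U' = choice s' q I hI c V' ∧ ∀ i, Red s p ℓ b (V i) (V' i) :=
  let ⟨n, h⟩ := h.exists_succ
  let ⟨V', e, h⟩ := h.inv_opp hU hs
  ⟨V', e, fun i => ⟨n, h i⟩⟩

end

theorem Red.out_ne_var {U U' : SType Role Label Base Θ} (h : Red s p ℓ b U U') (X : Θ) :
    U.out ≠ .var X := by
  obtain ⟨n, h⟩ := h
  intro e
  cases h with
  | base hU => rw [e] at hU; cases hU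
  | same hU => rw [e] at hU; cases hU
  | opp hU => rw [e] at hU; cases hU

/-! ### Commutation of reductions -/

/-- Reductions of opposite polarity commute, without increase in height. -/
theorem RedN.commute (hs : s' ≠ s) {T T' T₁ : SType Role Label Base Θ}
    (h : RedN s p ℓ b n T T') (h₁ : Red s' q ℓ' b' T T₁) :
    ∃ T₁', RedN s p ℓ b n T₁ T₁' ∧ Red s' q ℓ' b' T' T₁' := by
  induction h generalizing T₁ with
  | base hT hℓ hb =>
    obtain ⟨W, rfl, hW⟩ := h₁.inv_opp hT hs.symm
    exact ⟨W ⟨_, hℓ⟩, .base (out_choice ..) hℓ hb, hW _⟩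
  | same hT hpq J hJ hJI V' h ih =>
    obtain ⟨W, rfl, hW⟩ := h₁.inv_opp hT hs.symm
    choose W' hW₁ hW₂ using fun i : J => ih i (hW _)
    exact ⟨_, .same (out_choice ..) hpq J hJ hJI W' hW₁, .opp (out_choice ..) hs.symm _ hW₂⟩
  | @opp n T s'' r I hI c V hT hs' V' h ih =>
    obtain rfl : s'' = s' := by cases s <;> cases s' <;> cases s'' <;> simp_all
    by_cases hqr : q = r
    · subst hqr
      obtain ⟨hℓ, rfl, rfl⟩ := h₁.inv_base hT
      exact ⟨_, (h _).mono (Nat.le_succ _), .base (out_choice ..) ⟨ℓ', hℓ⟩⟩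
    · obtain ⟨J, hJ, hJI, W, rfl, hW⟩ := h₁.inv_same hT hqr
      choose W' hW₁ hW₂ using fun i : J => ih _ (hW i)
      exact ⟨_, .opp (out_choice ..) hs W' hW₁, .same (out_choice ..) hqr J hJ hJI _ hW₂⟩

/-- Reductions of equal polarity with different partners can be exchanged, simultaneously for a
family of labels. -/
theorem Red.exchange (hpq : p ≠ q) {U : SType Role Label Base Θ} {J : Finset Label}
    (hJ : J.Nonempty) {β : J → Base} {V' : J → SType Role Label Base Θ}
    (h : ∀ i : J, ∃ V, Red s q i.1 (β i) U V ∧ Red s p ℓ b V (V' i)) :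
    ∃ U', Red s p ℓ b U U' ∧ ∀ i : J, Red s q i.1 (β i) U' (V' i) := by
  classical
  choose V hV hV' using h
  obtain ⟨n, hn⟩ :=
    exists_uniform_height (ι := J) (P := fun i n => RedN s q i.1 (β i) n U (V i))
      (fun _ _ _ hmn h => h.mono hmn) hV
  replace hn : ∀ i : J, ∃ V, RedN s q i.1 (β i) n U V ∧ Red s p ℓ b V (V' i) :=
    fun i => ⟨V i, hn i, hV' i⟩
  clear hV hV' V
  induction n generalizing U J with
  | zero =>
    obtain ⟨i, hi⟩ := hJ
    obtain ⟨V, hV, -⟩ := hn ⟨i, hi⟩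
    cases hV
  | succ n ih =>
    have hU : ∃ s' r I hI c W, U.out = .choice s' r I hI c W := by
      obtain ⟨i, hi⟩ := hJ
      obtain ⟨V, hV, -⟩ := hn ⟨i, hi⟩
      cases hV with
      | base hU => exact ⟨_, _, _, _, _, _, hU⟩
      | same hU => exact ⟨_, _, _, _, _, _, hU⟩
      | opp hU => exact ⟨_, _, _, _, _, _, hU⟩
    obtain ⟨s', r, I, hI, c, W, hU⟩ := hU
    by_cases hs : s' = s
    · subst hs
      by_cases hq : r = q
      · subst hq
        have hinv : ∀ i : J, ∃ hi : i.1 ∈ I, c ⟨i, hi⟩ = β i ∧ Red s' p ℓ b (W ⟨i, hi⟩) (V' i) := by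
          intro i
          obtain ⟨V, hV, hV'⟩ := hn i
          obtain ⟨hi, hb, rfl⟩ := hV.inv_base hU
          exact ⟨hi, hb, hV'⟩
        have hJI : J ⊆ I := fun i hi => (hinv ⟨i, hi⟩).1
        refine ⟨_, .same hU hpq J hJ hJI V' fun i => (hinv i).2.2, fun i => ?_⟩
        rw [← (hinv i).2.1]
        exact Red.base (out_choice s' r J hJ (fun i => c ⟨i, hJI i.2⟩) V') i
      by_cases hp : r = p
      · subst hp
        have hinv : ∀ i : J, ∃ hℓ : ℓ ∈ I, c ⟨ℓ, hℓ⟩ = b ∧ Red s' q i.1 (β i) (W ⟨ℓ, hℓ⟩) (V' i) := by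
          intro i
          obtain ⟨V, hV, hV'⟩ := hn i
          obtain ⟨K, hK, hKI, W', rfl, hW'⟩ := hV.inv_same hU hpq.symm
          obtain ⟨hℓ, hb, h⟩ := hV'.inv_base (out_choice ..)
          rw [h]
          exact ⟨hKI hℓ, hb, n, hW' ⟨ℓ, hℓ⟩⟩
        obtain ⟨i, hi⟩ := hJ
        obtain ⟨hℓ, hb, -⟩ := hinv ⟨i, hi⟩
        subst hb
        exact ⟨_, .base hU ⟨ℓ, hℓ⟩, fun i => (hinv i).2.2⟩
      · have hinv : ∀ i : J, ∃ (K : Finset Label) (hK : K.Nonempty) (hKI : K ⊆ I)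
            (W' : K → SType Role Label Base Θ),
            V' i = choice s' r K hK (fun k => c ⟨k, hKI k.2⟩) W' ∧
            ∀ k : K, ∃ V, RedN s' q i.1 (β i) n (W ⟨k, hKI k.2⟩) V ∧ Red s' p ℓ b V (W' k) := by
          intro i
          obtain ⟨V, hV, hV'⟩ := hn i
          obtain ⟨K, hK, hKI, W', rfl, hW'⟩ := hV.inv_same hU (Ne.symm hq)
          obtain ⟨L, hL, hLK, W'', h, hW''⟩ := hV'.inv_same (out_choice ..) (Ne.symm hp)
          exact ⟨L, hL, hLK.trans hKI, W'', h, fun k => ⟨_, hW' ⟨k, hLK k.2⟩, hW'' k⟩⟩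
        choose K hK hKI W' hVW hW' using hinv
        -- Each label `i` retains its own set `K i` of branches, but the common target must serve
        -- all labels. It keeps the union, and each later reduction discards what it does not need.
        let L : Finset Label := J.attach.biUnion K
        have hLI : L ⊆ I := Finset.biUnion_subset.2 fun i _ => hKI i
        have hKL : ∀ i, K i ⊆ L := fun i => Finset.subset_biUnion_of_mem K (Finset.mem_attach J i)
        have hL : L.Nonempty := by
          obtain ⟨i, hi⟩ := hJ
          exact (hK ⟨i, hi⟩).mono (hKL _)
        have hstep : ∀ k : L, ∃ U', Red s' p ℓ b (W ⟨k, hLI k.2⟩) U' ∧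
            ∀ (i : J) (hk : k.1 ∈ K i), Red s' q i.1 (β i) U' (W' i ⟨k, hk⟩) := by
          intro k
          -- In branch `k` only the labels that retain `k` give data, so the induction hypothesis is
          -- applied to this subfamily.
          let M : Finset Label := J.filter fun i => ∃ hi : i ∈ J, k.1 ∈ K ⟨i, hi⟩
          have hMJ : ∀ i : M, i.1 ∈ J := fun i => (Finset.mem_filter.1 i.2).1
          have hMK : ∀ i : M, k.1 ∈ K ⟨i, hMJ i⟩ := fun i => (Finset.mem_filter.1 i.2).2.2
          have hM : M.Nonempty := by
            obtain ⟨i, -, hi⟩ := Finset.mem_biUnion.1 k.2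
            exact ⟨i, Finset.mem_filter.2 ⟨i.2, i.2, hi⟩⟩
          obtain ⟨U', hU', h⟩ := ih (U := W ⟨k, hLI k.2⟩) hM (β := fun i => β ⟨i, hMJ i⟩)
            (V' := fun i => W' ⟨i, hMJ i⟩ ⟨k, hMK i⟩) fun i => hW' ⟨i, hMJ i⟩ ⟨k, hMK i⟩
          exact ⟨U', hU', fun i hk => h ⟨i, Finset.mem_filter.2 ⟨i.2, i.2, hk⟩⟩⟩
        choose U' hU' hUW using hstep
        refine ⟨_, .same hU (Ne.symm hp) L hL hLI U' hU', fun i => ?_⟩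
        rw [hVW i]
        exact .same (out_choice ..) (Ne.symm hq) (K i) (hK i) (hKL i) (W' i) fun k => hUW _ _ k.2
    · have hinv : ∀ i : J, ∃ W' : I → SType Role Label Base Θ, V' i = choice s' r I hI c W' ∧
          ∀ k, ∃ V, RedN s q i.1 (β i) n (W k) V ∧ Red s p ℓ b V (W' k) := by
        intro i
        obtain ⟨V, hV, hV'⟩ := hn i
        obtain ⟨W', rfl, hW'⟩ := hV.inv_opp hU hs
        obtain ⟨W'', h, hW''⟩ := hV'.inv_opp (out_choice ..) hs
        exact ⟨W'', h, fun k => ⟨_, hW' k, hW'' k⟩⟩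
      choose W' hVW hW' using hinv
      choose U' hU' hUW using fun k => ih hJ (V' := fun i => W' i k) fun i => hW' i k
      refine ⟨_, .opp hU hs U' hU', fun i => ?_⟩
      rw [hVW i]
      exact .opp (out_choice ..) hs _ fun k => hUW k i

/-- A reduction of equal polarity with another partner only removes choices with that partner or
discards branches, so it cannot delay the choice with `p`. Keeping the bound is what the inner
induction of `SubP.seq` needs. -/
theorem SeqN.red {T T' : SType Role Label Base Θ} (h : SeqN s p n T) (hqp : q ≠ p)
    (hT' : Red s q ℓ b T T') : SeqN s p n T' := by
  induction h generalizing T' with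
  | base hT =>
    obtain ⟨J, hJ, hJI, V', rfl, -⟩ := hT'.inv_same hT hqp
    exact .base (out_choice ..)
  | @step n T r I hI c V hT h ih =>
    by_cases hqr : q = r
    · subst hqr
      obtain ⟨hℓ, -, rfl⟩ := hT'.inv_base hT
      exact (h _).mono (Nat.le_succ _)
    · obtain ⟨J, hJ, hJI, V', rfl, hV'⟩ := hT'.inv_same hT hqr
      exact .step (out_choice ..) fun i => ih _ (hV' i)

/-! ### Oriented subtyping -/

/-- The closure conditions of asynchronous subtyping, for a relation given together with its
converse. -/
structure IsSim (R : Bool → SType Role Label Base Θ → SType Role Label Base Θ → Prop) :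
    Prop where
  symm : ∀ {s s' T U}, s' ≠ s → R s T U → R s' U T
  step : ∀ {s T U}, R s T U → ∀ {p I hI b T'}, T.out = .choice s p I hI b T' →
    ∀ i : I, ∃ U', Red s p i.1 (b i) U U' ∧ R s (T' i) U'
  seq : ∀ {s s' T U}, R s T U → s' ≠ s → ∀ {p I hI b T'}, T.out = .choice s' p I hI b T' →
    Seq s' p U
  vars : ∀ {s T U}, R s T U → ∀ {X : Θ}, T.out = .var X → U.out = .var X

/-- Asynchronous subtyping of raw types for `s = true`, and its converse for `s = false`. -/
def SubP (s : Bool) (T U : SType Role Label Base Θ) : Prop :=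
  ∃ R : Bool → SType Role Label Base Θ → SType Role Label Base Θ → Prop, IsSim R ∧ R s T U

theorem isSim_subP : IsSim (SubP (Role := Role) (Label := Label) (Base := Base) (Θ := Θ)) where
  symm hs := fun ⟨R, hR, h⟩ => ⟨R, hR, hR.symm hs h⟩
  step := fun ⟨R, hR, h⟩ _ _ _ _ _ e i =>
    let ⟨U', h₁, h₂⟩ := hR.step h e i
    ⟨U', h₁, R, hR, h₂⟩
  seq := fun ⟨_, hR, h⟩ hs _ _ _ _ _ e => hR.seq h hs e
  vars := fun ⟨_, hR, h⟩ _ e => hR.vars h e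

theorem SubP.symm {T U : SType Role Label Base Θ} (h : SubP s T U) (hs : s' ≠ s) : SubP s' U T :=
  isSim_subP.symm hs h

theorem SubP.refl (s : Bool) (T : SType Role Label Base Θ) : SubP s T T := by
  refine ⟨fun _ T U => T = U, ⟨?_, ?_, ?_, ?_⟩, rfl⟩
  · rintro _ _ _ _ - rfl; rfl
  · rintro _ _ _ rfl _ _ _ _ _ e i; exact ⟨_, .base e i, rfl⟩
  · rintro _ _ _ _ rfl _ _ _ _ _ _ e; exact .base e
  · rintro _ _ _ rfl _ e; exact e

theorem SubP.congr {T T₁ U U₁ : SType Role Label Base Θ} (h : SubP s T U) (hT : T.out = T₁.out)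
    (hU : U.out = U₁.out) : SubP s T₁ U₁ := by
  refine ⟨fun s T₁ U₁ => ∃ T U, T.out = T₁.out ∧ U.out = U₁.out ∧ SubP s T U,
    ⟨?_, ?_, ?_, ?_⟩, T, U, hT, hU, h⟩
  · rintro _ _ _ _ hs ⟨T, U, hT, hU, h⟩
    exact ⟨U, T, hU, hT, h.symm hs⟩
  · rintro _ _ _ ⟨T, U, hT, hU, h⟩ _ _ _ _ _ e i
    obtain ⟨U', h₁, h₂⟩ := isSim_subP.step h (hT.trans e) i
    exact ⟨U', h₁.congr hU, _, _, rfl, rfl, h₂⟩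
  · rintro _ _ _ _ ⟨T, U, hT, hU, h⟩ hs _ _ _ _ _ e
    exact (isSim_subP.seq h hs (hT.trans e)).congr hU
  · rintro _ _ _ ⟨T, U, hT, hU, h⟩ _ e
    exact hU ▸ isSim_subP.vars h (hT.trans e)

/-- `T` is a choice all of whose branches are matched by reductions of `U`. -/
def Matched (s : Bool) (T U : SType Role Label Base Θ) : Prop :=
  ∃ q J hJ b T', T.out = .choice s q J hJ b T' ∧
    ∀ i : J, ∃ U', Red s q i.1 (b i) U U' ∧ SubP s (T' i) U'

/-- Matched pairs and their converses, added to `SubP`, form a simulation. The matching reductions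
slip under a head of opposite polarity and keep a head of equal polarity with another partner, so
the conditions seen from `U` follow from those of the matched branches. -/
theorem SubP.of_matched {T U : SType Role Label Base Θ} (h : Matched s T U) : SubP s T U := by
  refine ⟨fun s T U => SubP s T U ∨ Matched s T U ∨ ∃ s', s' ≠ s ∧ Matched s' U T,
    ⟨?_, ?_, ?_, ?_⟩, Or.inr (Or.inl h)⟩
  · rintro s s' T U hs (h | h | ⟨s'', hs'', h⟩)
    · exact Or.inl (h.symm hs)
    · exact Or.inr (Or.inr ⟨s, hs.symm, h⟩)
    · obtain rfl : s'' = s' := by cases s <;> cases s' <;> cases s'' <;> simp_all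
      exact Or.inr (Or.inl h)
  · rintro s T U (h | ⟨q, J, hJ, c, V, hT, h⟩ | ⟨s', hs, q, J, hJ, c, V, hU, h⟩) p I hI b T' e i
    · obtain ⟨U', h₁, h₂⟩ := isSim_subP.step h e i
      exact ⟨U', h₁, Or.inl h₂⟩
    · rw [e] at hT
      cases hT
      obtain ⟨U', h₁, h₂⟩ := h i
      exact ⟨U', h₁, Or.inl h₂⟩
    -- The reductions of `T` that match the branches of `U` act inside every branch of its head.
    -- Hence branch `i` of `T` again matches what `U` becomes once all its branches have answered
    -- `i`.
    · have key : ∀ j : J, ∃ V' W, Red s p i.1 (b i) (V j) V' ∧ Red s' q j.1 (c j) (T' i) W ∧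
          SubP s' V' W := by
        intro j
        obtain ⟨Tj, h₁, h₂⟩ := h j
        obtain ⟨W, rfl, hW⟩ := h₁.inv_opp e hs.symm
        obtain ⟨V', h₃, h₄⟩ := isSim_subP.step (h₂.symm hs.symm) (out_choice ..) i
        exact ⟨V', W i, h₃, hW i, h₄.symm hs⟩
      choose V' W h₁ h₂ h₃ using key
      exact ⟨_, .opp hU hs V' h₁, Or.inr (Or.inr ⟨s', hs, _, _, _, _, _, out_choice ..,
        fun j => ⟨W j, h₂ j, h₃ j⟩⟩)⟩
  · rintro s s' T U (h | ⟨q, J, hJ, c, V, hT, h⟩ | ⟨s'', hs, q, J, hJ, c, V, hU, h⟩) hs' p I hI b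
      T' e
    · exact isSim_subP.seq h hs' e
    · rw [e] at hT
      cases hT
      exact absurd rfl hs'
    · obtain rfl : s'' = s' := by cases s <;> cases s' <;> cases s'' <;> simp_all
      by_cases hpq : q = p
      · subst hpq
        exact .base hU
      · refine .step hU fun j => ?_
        obtain ⟨Tj, h₁, h₂⟩ := h j
        obtain ⟨K, hK, hKI, W, rfl, -⟩ := h₁.inv_same e hpq
        exact isSim_subP.seq (h₂.symm hs.symm) hs (out_choice ..)
  · rintro s T U (h | ⟨q, J, hJ, c, V, hT, h⟩ | ⟨s', hs, q, J, hJ, c, V, hU, h⟩) X e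
    · exact isSim_subP.vars h e
    · rw [e] at hT
      cases hT
    · obtain ⟨j, hj⟩ := hJ
      obtain ⟨_, h₁, -⟩ := h ⟨j, hj⟩
      exact absurd e (h₁.out_ne_var X)

/-! ### Transitivity -/

/-- The converse simulation answers each branch of `U` by a reduction of `T`. Either this consumes
the head of `T`, lowering `n`, or it leaves the head partner `q` in place while `U` comes closer to
its own choice with `q`, lowering `m`. -/
theorem SubP.seq {T U : SType Role Label Base Θ} (h : SubP s T U) (hs : s' ≠ s)
    (hT : SeqN s' p n T) : Seq s' p U := by
  induction n generalizing T U with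
  | zero => cases hT
  | succ n ih =>
    have hq : ∃ q I hI c V, T.out = .choice s' q I hI c V := by
      cases hT with
      | base hT => exact ⟨_, _, _, _, _, hT⟩
      | step hT => exact ⟨_, _, _, _, _, hT⟩
    -- Only the partner `q` is fixed; the branches at the head stay existential because they shrink
    -- during the inner induction.
    obtain ⟨q, hout⟩ := hq
    have hU : Seq s' q U := by
      obtain ⟨I, hI, c, V, hout⟩ := hout
      exact isSim_subP.seq h hs hout
    obtain ⟨m, hm⟩ := hU
    induction m generalizing T U with
    | zero => cases hm
    | succ m ihm =>
      obtain ⟨I, hI, c, V, hout⟩ := hout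
      have hr : ∃ r K hK d W, U.out = .choice s' r K hK d W ∧ (r = q ∨ ∀ k, SeqN s' q m (W k)) := by
        cases hm with
        | base hU => exact ⟨_, _, _, _, _, hU, Or.inl rfl⟩
        | step hU h => exact ⟨_, _, _, _, _, hU, Or.inr h⟩
      obtain ⟨r, K, hK, d, W, hU, hr⟩ := hr
      by_cases hrp : r = p
      · subst hrp
        exact .base hU
      refine .step hU fun k => ?_
      obtain ⟨T₁, h₁, h₂⟩ := isSim_subP.step (h.symm hs) hU k
      by_cases hrq : r = q
      · subst hrq
        obtain ⟨hk, -, rfl⟩ := h₁.inv_base hout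
        refine ih (h₂.symm hs.symm) ?_
        cases hT with
        | base hT => rw [hout] at hT; cases hT; exact absurd rfl hrp
        | step hT hV => rw [hout] at hT; cases hT; exact hV _
      · have hT₁ := hT.red hrp h₁
        obtain ⟨J, hJ, hJI, V', rfl, -⟩ := h₁.inv_same hout hrq
        exact ihm (h₂.symm hs.symm) hT₁ ⟨_, _, _, _, out_choice ..⟩ (hr.resolve_left hrq k)

/-- Under a head of equal polarity, the answers for the separate branches are merged by
`Red.exchange`. Under a head of opposite polarity, `U` is followed until it reaches the head partner
of `T`, as in `SubP.seq`. -/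
theorem SubP.red {T T' U : SType Role Label Base Θ} (h : SubP s T U)
    (hT : RedN s p ℓ b n T T') : ∃ U', Red s p ℓ b U U' ∧ SubP s T' U' := by
  induction n generalizing T T' U with
  | zero => cases hT
  | succ n ih =>
    have hcases := hT
    cases hcases with
    | base hout hℓ hb =>
      subst hb
      exact isSim_subP.step h hout ⟨ℓ, hℓ⟩
    | @same _ _ q I hI c V hout hpq J hJ hJI V' hV' =>
      have key : ∀ i : J, ∃ W', (∃ W, Red s q i.1 (c ⟨i, hJI i.2⟩) U W ∧ Red s p ℓ b W W') ∧
          SubP s (V' i) W' := by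
        intro i
        obtain ⟨W, h₁, h₂⟩ := isSim_subP.step h hout ⟨i, hJI i.2⟩
        obtain ⟨W', h₃, h₄⟩ := ih h₂ (hV' i)
        exact ⟨W', ⟨W, h₁, h₃⟩, h₄⟩
      choose W' h₁ h₂ using key
      obtain ⟨U', h₃, h₄⟩ := Red.exchange hpq hJ h₁
      exact ⟨U', h₃, .of_matched ⟨_, _, _, _, _, out_choice .., fun i => ⟨_, h₄ i, h₂ i⟩⟩⟩
    | @opp _ _ s' q I hI c V hout hs V' hV' =>
      obtain ⟨m, hm⟩ := isSim_subP.seq h hs hout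
      clear hV'
      -- The inner induction replaces `T'` by its own reducts, so its explicit form is forgotten and
      -- recovered by inversion when needed.
      generalize hT' : choice s' q I hI c V' = T' at hT
      clear hT' V'
      induction m generalizing T T' U I with
      | zero => cases hm
      | succ m ihm =>
        have hr : ∃ r K hK d W, U.out = .choice s' r K hK d W ∧
            (r = q ∨ ∀ k, SeqN s' q m (W k)) := by
          cases hm with
          | base hU => exact ⟨_, _, _, _, _, hU, Or.inl rfl⟩
          | step hU h => exact ⟨_, _, _, _, _, hU, Or.inr h⟩
        obtain ⟨r, K, hK, d, W, hU, hr⟩ := hr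
        have key : ∀ k : K, ∃ W' T₁', Red s p ℓ b (W k) W' ∧ Red s' r k.1 (d k) T' T₁' ∧
            SubP s T₁' W' := by
          intro k
          obtain ⟨T₁, h₁, h₂⟩ := isSim_subP.step (h.symm hs) hU k
          by_cases hrq : r = q
          · subst hrq
            obtain ⟨hk, hd, rfl⟩ := h₁.inv_base hout
            obtain ⟨V', rfl, hV'⟩ := hT.inv_opp hout hs
            obtain ⟨W', h₃, h₄⟩ := ih (h₂.symm hs.symm) (hV' ⟨k, hk⟩)
            rw [← hd]
            exact ⟨W', _, h₃, .base (out_choice ..) ⟨k.1, hk⟩, h₄⟩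
          -- The residual reduction has the same height, so the outer induction does not apply; the
          -- inner one does, as the head partner of `T₁` is still `q`.
          · obtain ⟨T₁', h₃, h₄⟩ := hT.commute hs h₁
            obtain ⟨J, hJ, hJI, V', rfl, -⟩ := h₁.inv_same hout hrq
            obtain ⟨W', h₅, h₆⟩ := ihm (h₂.symm hs.symm) (out_choice ..)
              (hr.resolve_left hrq k) _ h₃
            exact ⟨W', T₁', h₅, h₄, h₆⟩
        choose W' T₁' h₁ h₂ h₃ using key
        -- The new type is a choice of polarity `s'`, so the pair is established from its side: the
        -- commuted reductions of `T'` match its branches.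
        refine ⟨_, .opp hU hs W' h₁, SubP.symm (s := s') (.of_matched ?_) hs.symm⟩
        exact ⟨_, _, _, _, _, out_choice .., fun k => ⟨_, h₂ k, (h₃ k).symm hs⟩⟩

theorem SubP.trans {S T U : SType Role Label Base Θ} (h₁ : SubP s S T) (h₂ : SubP s T U) :
    SubP s S U := by
  refine ⟨fun s S U => ∃ T, SubP s S T ∧ SubP s T U, ⟨?_, ?_, ?_, ?_⟩, T, h₁, h₂⟩
  · rintro _ _ _ _ hs ⟨T, h₁, h₂⟩
    exact ⟨T, h₂.symm hs, h₁.symm hs⟩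
  · rintro _ _ _ ⟨T, h₁, h₂⟩ _ _ _ _ _ e i
    obtain ⟨T', ⟨n, hT'⟩, h₃⟩ := isSim_subP.step h₁ e i
    obtain ⟨U', hU', h₄⟩ := h₂.red hT'
    exact ⟨U', hU', _, h₃, h₄⟩
  · rintro _ _ _ _ ⟨T, h₁, h₂⟩ hs _ _ _ _ _ e
    obtain ⟨n, hn⟩ := isSim_subP.seq h₁ hs e
    exact h₂.seq hs hn
  · rintro _ _ _ ⟨T, h₁, h₂⟩ _ e
    exact isSim_subP.vars h₂ (isSim_subP.vars h₁ e)

/-! ### Substitution in oriented subtyping -/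

theorem RedN.subst {U U' : SType Role Label Base Θ} (h : RedN s p ℓ b n U U')
    (σ : Θ → SType Role Label Base Θ₁) : RedN s p ℓ b n (U.subst σ) (U'.subst σ) := by
  induction h with
  | base hU hℓ hb => exact .base (out_subst_of_choice hU σ) hℓ hb
  | same hU hpq J hJ hJI V' h ih =>
    rw [choice_subst]
    exact .same (out_subst_of_choice hU σ) hpq J hJ hJI _ ih
  | opp hU hs V' h ih =>
    rw [choice_subst]
    exact .opp (out_subst_of_choice hU σ) hs _ ih

theorem SeqN.subst {T : SType Role Label Base Θ} (h : SeqN s p n T)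
    (σ : Θ → SType Role Label Base Θ₁) : SeqN s p n (T.subst σ) := by
  induction h with
  | base hT => exact .base (out_subst_of_choice hT σ)
  | step hT h ih => exact .step (out_subst_of_choice hT σ) ih

/-- Oriented subtyping, or subtyping below the substitutions `ρ true` and `ρ false` between types
whose unfolding is not a variable. -/
def SubstRel (ρ : Bool → Θ → SType Role Label Base Θ₁) (s : Bool)
    (T U : SType Role Label Base Θ₁) : Prop :=
  SubP s T U ∨ ∃ T' U' : SType Role Label Base Θ, SubP s T' U' ∧ (∀ X, T'.out ≠ .var X) ∧
    T.out = (T'.subst (ρ s)).out ∧ U.out = (U'.subst (ρ !s)).out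

theorem SubstRel.congr {ρ : Bool → Θ → SType Role Label Base Θ₁}
    {T T₁ U U₁ : SType Role Label Base Θ₁} (h : SubstRel ρ s T U)
    (hT : T.out = T₁.out) (hU : U.out = U₁.out) : SubstRel ρ s T₁ U₁ := by
  rcases h with h | ⟨T', U', h, hv, h₁, h₂⟩
  · exact Or.inl (h.congr hT hU)
  · exact Or.inr ⟨T', U', h, hv, hT ▸ h₁, hU ▸ h₂⟩

theorem SubstRel.symm {ρ : Bool → Θ → SType Role Label Base Θ₁}
    {T U : SType Role Label Base Θ₁} (h : SubstRel ρ s T U) (hs : s' ≠ s) :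
    SubstRel ρ s' U T := by
  obtain rfl : s' = !s := Bool.eq_not.2 hs
  rcases h with h | ⟨T', U', h, hv, h₁, h₂⟩
  · exact Or.inl (h.symm hs)
  · refine Or.inr ⟨U', T', h.symm hs, fun X hX => hv X ?_, h₂, ?_⟩
    · exact isSim_subP.vars (h.symm hs) hX
    · rwa [Bool.not_not]

theorem SubstRel.subst {ρ : Bool → Θ → SType Role Label Base Θ₁}
    (hρ : ∀ X s, SubstRel ρ s (ρ s X) (ρ (!s) X)) {T U : SType Role Label Base Θ}
    (h : SubP s T U) : SubstRel ρ s (T.subst (ρ s)) (U.subst (ρ !s)) := by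
  by_cases hv : ∃ X, T.out = .var X
  · obtain ⟨X, hX⟩ := hv
    exact (hρ X s).congr (out_subst_of_var hX _).symm
      (out_subst_of_var (isSim_subP.vars h hX) _).symm
  · push Not at hv
    exact Or.inr ⟨T, U, h, hv, rfl, rfl⟩

/-- A head that is not a variable is unaffected by substitution, so each condition is inherited from
the original types. After one step the residuals may be variables, and there `hρ` takes over; it may
refer to `SubstRel` itself since a layer has been consumed. -/
theorem isSim_substRel {ρ : Bool → Θ → SType Role Label Base Θ₁}
    (hρ : ∀ X s, SubstRel ρ s (ρ s X) (ρ (!s) X)) : IsSim (SubstRel ρ) := by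
  have inv : ∀ {T : SType Role Label Base Θ} {σ : Θ → SType Role Label Base Θ₁},
      (∀ X, T.out ≠ .var X) → (T.subst σ).out = .fin ∨ ∃ s p I hI b T',
        T.out = .choice s p I hI b T' ∧
          (T.subst σ).out = .choice s p I hI b (fun i => (T' i).subst σ) := by
    intro T σ hv
    cases hT : T.out with
    | fin => exact Or.inl (out_subst_of_fin hT σ)
    | var X => exact absurd hT (hv X)
    | choice s p I hI b T' =>
      exact Or.inr ⟨_, _, _, _, _, _, rfl, out_subst_of_choice hT σ⟩
  refine ⟨fun hs h => h.symm hs, ?_, ?_, ?_⟩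
  · rintro s T U (h | ⟨T₁, U₁, h, hv, hT, hU⟩) p I hI b T' e i
    · obtain ⟨U', h₁, h₂⟩ := isSim_subP.step h e i
      exact ⟨U', h₁, Or.inl h₂⟩
    · rcases inv (σ := ρ s) hv with h' | ⟨_, _, _, _, _, V, h₁, h₂⟩
      · rw [← hT, e] at h'
        cases h'
      · rw [← hT, e] at h₂
        cases h₂
        obtain ⟨U', ⟨n, h₃⟩, h₄⟩ := isSim_subP.step h h₁ i
        exact ⟨_, ⟨n, (h₃.subst _).congr hU.symm⟩, SubstRel.subst hρ h₄⟩
  · rintro s s' T U (h | ⟨T₁, U₁, h, hv, hT, hU⟩) hs p I hI b T' e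
    · exact isSim_subP.seq h hs e
    · rcases inv (σ := ρ s) hv with h' | ⟨_, _, _, _, _, V, h₁, h₂⟩
      · rw [← hT, e] at h'
        cases h'
      · rw [← hT, e] at h₂
        cases h₂
        obtain ⟨n, h₃⟩ := isSim_subP.seq h hs h₁
        exact ⟨n, (h₃.subst _).congr hU.symm⟩
  · rintro s T U (h | ⟨T₁, U₁, h, hv, hT, hU⟩) X e
    · exact isSim_subP.vars h e
    · rcases inv (σ := ρ s) hv with h' | ⟨_, _, _, _, _, V, h₁, h₂⟩
      · rw [← hT, e] at h'
        cases h'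
      · rw [← hT, e] at h₂
        cases h₂

theorem SubP.subst {T U : SType Role Label Base Θ} (h : SubP true T U)
    {σ τ : Θ → SType Role Label Base Θ₁} (hστ : ∀ X, SubP true (σ X) (τ X)) :
    SubP true (T.subst σ) (U.subst τ) := by
  let ρ : Bool → Θ → SType Role Label Base Θ₁ := fun s => cond s σ τ
  have hρ : ∀ X s, SubstRel ρ s (ρ s X) (ρ (!s) X) := by
    intro X s
    cases s
    exacts [Or.inl ((hστ X).symm Bool.false_ne_true), Or.inl (hστ X)]
  exact ⟨_, isSim_substRel hρ, SubstRel.subst (s := true) hρ h⟩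

theorem SubP.mu {T U : SType Role Label Base (Option Θ)} (h : SubP true T U)
    (hT : T.GuardedIn none) (hU : U.GuardedIn none) : SubP true (mu T) (mu U) := by
  let ρ : Bool → Option Θ → SType Role Label Base Θ :=
    fun s o => o.elim (cond s (SType.mu T) (SType.mu U)) var
  have hmu : SubstRel ρ true (SType.mu T) (SType.mu U) := by
    by_cases hv : ∃ o, T.out = .var o
    · obtain ⟨o, ho⟩ := hv
      cases o with
      | none => exact absurd (out_eq_var.1 ho) hT.unfold_ne
      | some Y =>
        -- Both recursive types unfold to the same free variable.
        refine Or.inl ((SubP.refl true (var Y)).congr ?_ ?_)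
        · rw [← out_inst_mu hT, inst, out_subst_of_var ho]
          rfl
        · rw [← out_inst_mu hU, inst, out_subst_of_var (isSim_subP.vars h ho)]
          rfl
    · push Not at hv
      -- A recursive type and its one-step unfolding differ as terms but share their head, which is
      -- all that `SubstRel` compares.
      exact Or.inr ⟨T, U, h, hv, (out_inst_mu hT).symm, (out_inst_mu hU).symm⟩
  have hρ : ∀ X s, SubstRel ρ s (ρ s X) (ρ (!s) X) := by
    intro X s
    cases X with
    | none =>
      cases s
      exacts [hmu.symm Bool.false_ne_true, hmu]
    | some Y => exact Or.inl (.refl _ _)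
  exact ⟨_, isSim_substRel hρ, hmu⟩

/-! ### Comparison with the inductive definitions -/

/-- The inductively defined reduction of the given polarity. -/
def RedOf (s : Bool) (p : Role) (ℓ : Label) (b : Base) (U U' : SType Role Label Base Θ) : Prop :=
  match s with
  | true => RedSend p ℓ b U U'
  | false => RedRecv p ℓ b U U'

/-- The inductively defined predicate of the given polarity. -/
def SeqOf (s : Bool) (p : Role) (T : SType Role Label Base Θ) : Prop :=
  match s with
  | true => Sends p T
  | false => Recvs p T

theorem RedOf.of_unfold {U U' : SType Role Label Base Θ} (hU : U.WF)
    (h : RedOf s p ℓ b U.unfold U') : RedOf s p ℓ b U U' := by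
  cases s with
  | true => exact SType.of_unfold (P := fun U => RedSend p ℓ b U U') (fun T h => .mu T _ h) hU h
  | false => exact SType.of_unfold (P := fun U => RedRecv p ℓ b U U') (fun T h => .mu T _ h) hU h

theorem RedN.redOf {U U' : SType Role Label Base Θ} (h : RedN s p ℓ b n U U') (hU : U.WF) :
    RedOf s p ℓ b U U' := by
  induction h with
  | base hout hℓ hb =>
    refine RedOf.of_unfold hU ?_
    rw [out_eq_choice.1 hout]
    cases s
    exacts [RedRecv.base _ _ _ _ hℓ hb, RedSend.base _ _ _ _ hℓ hb]
  | same hout hpq J hJ hJI V' h ih =>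
    refine RedOf.of_unfold hU ?_
    rw [out_eq_choice.1 hout]
    have ih := fun i => ih i (hU.of_out hout _)
    cases s
    exacts [RedRecv.recv _ hpq _ _ _ _ hJI _ _ _ ih, RedSend.send _ hpq _ _ _ _ hJI _ _ _ ih]
  | @opp _ _ s' _ _ _ _ _ hout hs V' h ih =>
    refine RedOf.of_unfold hU ?_
    rw [out_eq_choice.1 hout]
    have ih := fun i => ih i (hU.of_out hout _)
    obtain rfl : s' = !s := Bool.eq_not.2 hs
    cases s
    exacts [RedRecv.send _ _ _ _ _ _ ih, RedSend.recv _ _ _ _ _ _ ih]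

theorem RedOf.red {U U' : SType Role Label Base Θ} (h : RedOf s p ℓ b U U') (hU : U.WF) :
    Red s p ℓ b U U' := by
  cases s with
  | true =>
    change RedSend p ℓ b U U' at h
    induction h with
    | base I hI c U hℓ hb => subst hb; exact Red.base (s := true) rfl ⟨ℓ, hℓ⟩
    | send q hpq I J hI hJ hJI c U U' h ih =>
      exact Red.same (s := true) rfl hpq J hJ hJI U' fun i => ih i (hU _)
    | recv q I hI c U U' h ih =>
      exact Red.opp (s' := false) rfl Bool.false_ne_true U' fun i => ih i (hU i)
    | mu U U' h ih => exact (ih (hU.2.inst hU)).congr (out_inst_mu hU.1)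
  | false =>
    change RedRecv p ℓ b U U' at h
    induction h with
    | base I hI c U hℓ hb => subst hb; exact Red.base (s := false) rfl ⟨ℓ, hℓ⟩
    | recv q hpq I J hI hJ hJI c U U' h ih =>
      exact Red.same (s := false) rfl hpq J hJ hJI U' fun i => ih i (hU _)
    | send q I hI c U U' h ih =>
      exact Red.opp (s' := true) rfl Bool.false_ne_true.symm U' fun i => ih i (hU i)
    | mu U U' h ih => exact (ih (hU.2.inst hU)).congr (out_inst_mu hU.1)

theorem SeqOf.seq {T : SType Role Label Base Θ} (h : SeqOf s p T) (hT : T.WF) : Seq s p T := by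
  cases s with
  | true =>
    change Sends p T at h
    induction h with
    | base I hI b T => exact Seq.base (s := true) rfl
    | send q I hI b T h ih => exact Seq.step (s := true) rfl fun i => ih i (hT i)
    | mu T h ih =>
      obtain ⟨n, hn⟩ := ih hT.2
      exact ⟨n, (hn.subst _).congr (out_inst_mu hT.1)⟩
  | false =>
    change Recvs p T at h
    induction h with
    | base I hI b T => exact Seq.base (s := false) rfl
    | recv q I hI b T h ih => exact Seq.step (s := false) rfl fun i => ih i (hT i)
    | mu T h ih =>
      obtain ⟨n, hn⟩ := ih hT.2
      exact ⟨n, (hn.subst _).congr (out_inst_mu hT.1)⟩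

theorem SeqOf.mu {T : SType Role Label Base (Option Θ)} (h : SeqOf s p T) :
    SeqOf s p (SType.mu T) := by
  cases s
  exacts [Recvs.mu T h, Sends.mu T h]

theorem SeqOf.choice {I : Finset Label} {hI : I.Nonempty} {b : I → Base}
    {T : I → SType Role Label Base Θ} (h : q = p ∨ ∀ i, SeqOf s p (T i)) :
    SeqOf s p (choice s q I hI b T) := by
  rcases h with rfl | h <;> cases s
  exacts [Recvs.base .., Sends.base .., Recvs.recv _ _ _ _ _ h, Sends.send _ _ _ _ _ h]

/-- If a substitution instance of `T` satisfies `SeqN`, then this is due to `T` itself or to a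
type substituted into it. -/
theorem SeqN.seqOf_or (n : ℕ) {T : SType Role Label Base Θ} (hT : T.WF) {Θ₁ : Type u}
    {σ : Θ → SType Role Label Base Θ₁} (hσ : ∀ X, (σ X).WF) (h : SeqN s p n (T.subst σ)) :
    SeqOf s p T ∨ ∃ X, ∃ m ≤ n, (T.GuardedIn X → m < n) ∧ SeqN s p m (σ X) := by
  induction n using Nat.strong_induction_on generalizing Θ Θ₁ with
  | _ n ihn =>
  have hchoice : ∀ {Θ : Type u} (s' : Bool) (q : Role) (I : Finset Label) (hI : I.Nonempty)
      (b : I → Base) (T : I → SType Role Label Base Θ) {Θ₁ : Type u}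
      {σ : Θ → SType Role Label Base Θ₁}, (∀ i, (T i).WF) → (∀ X, (σ X).WF) →
      SeqN s p n ((choice s' q I hI b T).subst σ) → SeqOf s p (choice s' q I hI b T) ∨
        ∃ X, ∃ m < n, SeqN s p m (σ X) := by
    intro Θ s' q I hI b T Θ₁ σ hT hσ h
    rw [choice_subst] at h
    cases h with
    | base e =>
      rw [out_choice] at e
      cases e
      exact Or.inl (.choice (Or.inl rfl))
    | @step n _ _ _ _ _ _ e h =>
      rw [out_choice] at e
      cases e
      by_cases hall : ∀ i, SeqOf s p (T i)
      · exact Or.inl (.choice (Or.inr hall))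
      · push Not at hall
        obtain ⟨i, hi⟩ := hall
        obtain ⟨X, m, hm, -, h'⟩ :=
          (ihn n (Nat.lt_succ_self n) (hT i) hσ (h i)).resolve_left hi
        exact Or.inr ⟨X, m, Nat.lt_succ_of_le hm, h'⟩
  induction T generalizing Θ₁ with
  | fin => cases h with
    | base e => cases e
    | step e => cases e
  | send q I hI b T ih =>
    exact (hchoice true q I hI b T hT hσ h).imp id
      fun ⟨X, m, hm, h⟩ => ⟨X, m, hm.le, fun _ => hm, h⟩
  | recv q I hI b T ih =>
    exact (hchoice false q I hI b T hT hσ h).imp id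
      fun ⟨X, m, hm, h⟩ => ⟨X, m, hm.le, fun _ => hm, h⟩
  | var X => exact Or.inr ⟨X, n, le_rfl, fun h => absurd rfl h, h⟩
  | mu T ih =>
    have hmu := hT.subst hσ
    have h' := h.congr (out_inst_mu hmu.1).symm
    rw [inst_subst_lift] at h'
    have hσ' : ∀ o : Option _, (o.elim ((SType.mu T).subst σ) σ).WF := by
      intro o
      cases o
      exacts [hmu, hσ _]
    rcases ih hT.2 hσ' h' with h' | ⟨o, m, hm, hg, h'⟩
    · exact Or.inl h'.mu
    · cases o with
      | some X => exact Or.inr ⟨X, m, hm, hg, h'⟩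
      | none =>
        -- The obligation has been passed to the recursive type itself through its bound variable.
        -- Guardedness makes the bound strictly smaller, so the outer induction applies to the same
        -- type.
        have hmn := hg hT.1
        refine (ihn m hmn hT hσ h').imp id ?_
        rintro ⟨X, k, hk, -, h'⟩
        exact ⟨X, k, hk.trans hm, fun _ => hk.trans_lt hmn, h'⟩

theorem Seq.seqOf {T : SType Role Label Base Θ} (h : Seq s p T) (hT : T.WF) : SeqOf s p T := by
  obtain ⟨n, h⟩ := h
  -- Viewed as its own instance under the identity substitution, the type can pass the obligation
  -- only to variables, which have no choice at their head.
  rw [← subst_var T] at h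
  rcases SeqN.seqOf_or n hT (σ := var) (fun _ => trivial) h with h | ⟨X, m, -, -, h⟩
  · exact h
  · cases h with
    | base e => cases e
    | step e => cases e

/-! ### Agreement of `Sub` and `SubP` on session types. -/

theorem RedN.wf {U U' : SType Role Label Base Θ} (h : RedN s p ℓ b n U U') (hU : U.WF) :
    U'.WF := by
  induction h with
  | base hout hℓ hb => exact hU.of_out hout _
  | same hout hpq J hJ hJI V' h ih => exact wf_choice.2 fun i => ih i (hU.of_out hout _)
  | opp hout hs V' h ih => exact wf_choice.2 fun i => ih i (hU.of_out hout _)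

theorem Sub.wf {T U : SType Role Label Base Θ} (h : T.Sub U) : T.WF ∧ U.WF :=
  let ⟨_, hR, h⟩ := h
  hR.wf _ _ h

theorem Sub.subP {T U : SType Role Label Base Θ} (h : T.Sub U) : SubP true T U := by
  obtain ⟨R, hR, h⟩ := h
  refine ⟨fun s T U => cond s (R T U) (R U T), ⟨?_, ?_, ?_, ?_⟩, h⟩
  · intro s s' T U hs h
    cases s <;> cases s' <;> first | exact absurd rfl hs | exact h
  · intro s T U h p I hI b T' e i
    rw [out_eq_choice] at e
    cases s with
    | true =>
      obtain ⟨U', h₁, h₂⟩ := hR.left_send _ _ h _ _ _ _ _ e i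
      exact ⟨U', RedOf.red (s := true) h₁ (hR.wf _ _ h).2, h₂⟩
    | false =>
      obtain ⟨U', h₁, h₂⟩ := hR.right_recv _ _ h _ _ _ _ _ e i
      exact ⟨U', RedOf.red (s := false) h₁ (hR.wf _ _ h).1, h₂⟩
  · intro s s' T U h hs p I hI b T' e
    rw [out_eq_choice] at e
    obtain rfl : s' = !s := Bool.eq_not.2 hs
    cases s with
    | true => exact SeqOf.seq (s := false) (hR.left_recv _ _ h _ _ _ _ _ e) (hR.wf _ _ h).2
    | false => exact SeqOf.seq (s := true) (hR.right_send _ _ h _ _ _ _ _ e) (hR.wf _ _ h).1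
  · intro s T U h X e
    rw [out_eq_var] at e ⊢
    cases s
    exacts [(hR.vars _ _ h X).2 e, (hR.vars _ _ h X).1 e]

theorem SubP.sub {T U : SType Role Label Base Θ} (h : SubP true T U) (hT : T.WF) (hU : U.WF) :
    T.Sub U := by
  have hft : false ≠ true := Bool.false_ne_true
  refine ⟨fun T U => T.WF ∧ U.WF ∧ SubP true T U, ⟨?_, ?_, ?_, ?_, ?_, ?_⟩, hT, hU, h⟩
  · exact fun _ _ h => ⟨h.1, h.2.1⟩
  · rintro T U ⟨hT, hU, h⟩ p I hI b T' e i
    replace e := out_eq_choice (s := true).2 e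
    obtain ⟨U', ⟨n, h₁⟩, h₂⟩ := isSim_subP.step h e i
    exact ⟨U', h₁.redOf hU, hT.of_out e i, h₁.wf hU, h₂⟩
  · rintro T U ⟨hT, hU, h⟩ p I hI b T' e
    exact (isSim_subP.seq h hft (out_eq_choice (s := false).2 e)).seqOf hU
  · rintro T U ⟨hT, hU, h⟩ p I hI b U' e
    exact (isSim_subP.seq (h.symm hft) hft.symm (out_eq_choice (s := true).2 e)).seqOf hT
  · rintro T U ⟨hT, hU, h⟩ p I hI b U' e i
    replace e := out_eq_choice (s := false).2 e
    obtain ⟨T', ⟨n, h₁⟩, h₂⟩ := isSim_subP.step (h.symm hft) e i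
    exact ⟨T', h₁.redOf hT, h₁.wf hT, hU.of_out e i, h₂.symm hft.symm⟩
  · rintro T U ⟨hT, hU, h⟩ X
    rw [← out_eq_var, ← out_eq_var]
    exact ⟨isSim_subP.vars h, isSim_subP.vars (h.symm hft)⟩

end SType

/-! ### The lemma on asynchronous subtyping. -/

theorem mainTheorem8 {Role Label Base : Type v} {V : Type u} (Θ : Set V) :
    -- reflexivity
    (∀ T : SType Role Label Base ↥Θ, T.WF → T.Sub T) ∧
    -- transitivity
    (∀ S T U : SType Role Label Base ↥Θ, S.Sub T → T.Sub U → S.Sub U) ∧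
    -- internal choice
    (∀ (p : Role) (I J : Finset Label) (hI : I.Nonempty) (hJ : J.Nonempty) (hJI : J ⊆ I)
      (b : I → Base) (T : J → SType Role Label Base ↥Θ) (U : I → SType Role Label Base ↥Θ),
      (∀ i, (U i).WF) → (∀ i : J, (T i).Sub (U ⟨i, hJI i.2⟩)) →
      (SType.send p J hJ (fun i => b ⟨i, hJI i.2⟩) T).Sub (SType.send p I hI b U)) ∧
    -- external choice
    (∀ (p : Role) (I J : Finset Label) (hI : I.Nonempty) (hJ : J.Nonempty) (hJI : J ⊆ I)
      (b : I → Base) (T : I → SType Role Label Base ↥Θ) (U : J → SType Role Label Base ↥Θ),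
      (∀ i, (T i).WF) → (∀ i : J, (T ⟨i, hJI i.2⟩).Sub (U i)) →
      (SType.recv p I hI b T).Sub (SType.recv p J hJ (fun i => b ⟨i, hJI i.2⟩) U)) ∧
    -- recursion
    (∀ (X : V), X ∉ Θ → ∀ T U : SType Role Label Base ↥(insert X Θ),
      (SType.muVar X T).WF → (SType.muVar X U).WF → T.Sub U →
      (SType.muVar X T).Sub (SType.muVar X U)) ∧
    -- substitution, for variables from an arbitrary set
    (∀ (Ξ : Set V) (T U : SType Role Label Base ↥Ξ) (σ τ : ↥Ξ → SType Role Label Base ↥Θ),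
      T.Sub U → (∀ X, (σ X).Sub (τ X)) → (T.subst σ).Sub (U.subst τ)) := by
  have hft : false ≠ true := Bool.false_ne_true
  refine ⟨fun T hT => (SType.SubP.refl true T).sub hT hT, ?_, ?_, ?_, ?_, ?_⟩
  · intro S T U h₁ h₂
    exact (h₁.subP.trans h₂.subP).sub h₁.wf.1 h₂.wf.2
  · intro p I J hI hJ hJI b T U hU h
    refine SType.SubP.sub (.of_matched ⟨p, J, hJ, _, T, rfl, fun i => ?_⟩)
      (fun i => (h i).wf.1) hU
    exact ⟨_, SType.Red.base (U := .send p I hI b U) rfl ⟨i, hJI i.2⟩, (h i).subP⟩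
  · intro p I J hI hJ hJI b T U hT h
    refine SType.SubP.sub (SType.SubP.symm (s := false) (.of_matched
      ⟨p, J, hJ, _, U, rfl, fun i => ?_⟩) hft.symm) hT (fun i => (h i).wf.2)
    exact ⟨_, SType.Red.base (U := .recv p I hI b T) rfl ⟨i, hJI i.2⟩, (h i).subP.symm hft⟩
  · intro X _ T U hT hU h
    refine SType.SubP.sub (SType.SubP.mu ?_ hT.1 hU.1) hT hU
    -- Passing from the named variable to the bound one is a substitution of variables for
    -- variables, so subtyping is preserved by the substitution property.
    rw [SType.rename_eq_subst, SType.rename_eq_subst]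
    exact h.subP.subst fun _ => .refl _ _
  · intro Ξ T U σ τ h hστ
    exact (h.subP.subst fun X => (hστ X).subP).sub
      (h.wf.1.subst fun X => (hστ X).wf.1) (h.wf.2.subst fun X => (hστ X).wf.2)
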